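/- Let $n \ge 2$ points $p_1 < p_2 < \dots < p_n$ on a line be given in sorted order. Call weights $w_{ij}\ge 0$ ($1\le i,j\le n$) with $w_{ij}=w_{ji}$, $w_{ii}=0$ and $\sum_{j} w_{ij}\ge 1$ for every $i$ *admissible*, and let $Q=\sum_{i=1}^n v_i^2$ with $v_i=\bigl|\sum_{j} w_{ij}(p_j-p_i)\bigr|$ be the Daitch–Kelner–Spielman quality measure. Then admissible weights that minimize $Q$ over all admissible weights can be computed in $O(n^2)$ time: there are a single program for a real random access machine (unit-cost real arithmetic $+,-,\times,/$, comparisons, index arithmetic, indirect addressing; no rounding) and a constant $C$ such that, for every $n\ge 2$ and every such input, the program halts after at most $Cn^2$ steps, and it outputs numbers $w_1,\dots,w_{n-1}$ such that the weights $w_{i,i+1}=w_{i+1,i}=w_i$, with all other weights zero, are optimal. The computation has the following form. Let $d_i=p_{i+1}-p_i$ and $\xi_i=2d_id_{i+1}$. For $2\le i\le n-1$ and $x\ge 0$ let $Q_i(x)$ be the minimum of $$d_i^2w_i^2+d_1^2w_1^2+\sum_{j=2}^{i}(d_jw_j-d_{j-1}w_{j-1})^2$$ over all $w_1,\dots,w_i\ge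 0$ with $w_i=x$, $w_1\ge 1$ and $w_j+w_{j+1}\ge 1$ for $2\le j\le i-1$. The minimum is attained, $Q_i$ is differentiable on $[0,\infty)$ (one-sidedly at $0$), and its derivative $R_i$ is strictly increasing and takes every value $y\ge 0$ exactly once, so that $R_i^{-1}(y)$ is defined. When the program halts, its memory holds, besides the weights, a representation of $R_2,\dots,R_{n-1}$: 1. If $n \ge 3$: for $R_2$, its breakpoint and the coefficients of its two linear pieces. 2. For each $R_{i+1}$ with $2\le i\le n-2$, the matrix $M_{i+1}$ and, if $R_i^{-1}(0)<1$, also a breakpoint $(x^*,y^*)$ with $0<x^*<1$ and $y^*=R_{i+1}(x^*)$ and the matrix $L_{i+1}$ (a flag tells whether there is a breakpoint), where $$M_{i+1}=\begin{pmatrix}0&1/\xi_i&0\\-\xi_i&4d_{i+1}^2/\xi_i&0\\0&0&1\end{pmatrix},\qquad L_{i+1}=\begin{pmatrix}-1&0&1\\-2\xi_i-4d_{i+1}^2&-1&\xi_i+4d_{i+1}^2\\0&0&1\end{pmatrix}.$$ Each point $(x,R_{i+1}(x),1)^T$ with $x\ge 0$ is the image of some $(x_0,R_i(x_0),1)^T$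 with $x_0\ge0$, under $L_{i+1}$ if there is a breakpoint and $x\le x^*$, and under $M_{i+1}$ if there is no breakpoint or $x\ge x^*$. The weights satisfy, for $n\ge 3$, $$w_{n-1}=\max\{R_{n-1}^{-1}(0),1\},\qquad w_i=\max\{R_i^{-1}(\xi_iw_{i+1}),\,1-w_{i+1}\}\ \ (2\le i\le n-2),\qquad w_1=\max\Bigl\{\tfrac{d_2}{2d_1}w_2,\,1\Bigr\},$$ and $w_1=1$ for $n=2$. -/

import Mathlib

namespace DKS

/-! ### The optimization problem

Points and weights are indexed from `1` to `n`; values at other indices play no role. -/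

/-- The vector attached to the point `p i` by the weights `W`. -/
def resid (n : ℕ) (p : ℕ → ℝ) (W : ℕ → ℕ → ℝ) (i : ℕ) : ℝ :=
  ∑ j ∈ Finset.Icc 1 n, W i j * (p j - p i)

/-- The Daitch-Kelner-Spielman quality measure: the sum of the squared lengths. -/
def quality (n : ℕ) (p : ℕ → ℝ) (W : ℕ → ℕ → ℝ) : ℝ :=
  ∑ i ∈ Finset.Icc 1 n, ‖resid n p W i‖ ^ 2

/-- The admissible weights on all pairs of `n` points. -/
structure Feasible (n : ℕ) (W : ℕ → ℕ → ℝ) : Prop where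
  nonneg : ∀ i ∈ Finset.Icc 1 n, ∀ j ∈ Finset.Icc 1 n, 0 ≤ W i j
  symm : ∀ i ∈ Finset.Icc 1 n, ∀ j ∈ Finset.Icc 1 n, W i j = W j i
  diag : ∀ i ∈ Finset.Icc 1 n, W i i = 0
  one_le_sum : ∀ i ∈ Finset.Icc 1 n, 1 ≤ ∑ j ∈ Finset.Icc 1 n, W i j

/-- `W` is an optimal set of weights among all admissible ones. -/
def IsOptimal (n : ℕ) (p : ℕ → ℝ) (W : ℕ → ℕ → ℝ) : Prop :=
  Feasible n W ∧ ∀ W' : ℕ → ℕ → ℝ, Feasible n W' → quality n p W ≤ quality n p W'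

/-- The weights on all pairs that are `w i` on the pair `{i, i + 1}` and `0` on pairs of points
that are not consecutive. -/
def chainWeights (w : ℕ → ℝ) (i j : ℕ) : ℝ :=
  if j = i + 1 then w i else if i = j + 1 then w j else 0

/-! ### The partial quality measures and their derivatives -/

/-- `d i = p (i + 1) - p i`. -/
def gap (p : ℕ → ℝ) (i : ℕ) : ℝ := p (i + 1) - p i

/-- `ξ i = 2 * d i * d (i + 1)`. -/
def xi (d : ℕ → ℝ) (i : ℕ) : ℝ := 2 * d i * d (i + 1)

/-- The quantity `Q i` as a function of the weights `w 1, …, w i`. -/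
def partialQ (d : ℕ → ℝ) (i : ℕ) (w : ℕ → ℝ) : ℝ :=
  d i ^ 2 * w i ^ 2 + d 1 ^ 2 * w 1 ^ 2
    + ∑ j ∈ Finset.Icc 2 i, (d j * w j - d (j - 1) * w (j - 1)) ^ 2

/-- The constraints on `w 1, …, w i` in the definition of the one-parameter function. -/
structure PrefixFeasible (i : ℕ) (w : ℕ → ℝ) : Prop where
  nonneg : ∀ j, 1 ≤ j → j ≤ i → 0 ≤ w j
  one_le_first : 1 ≤ w 1
  one_le_add : ∀ j, 2 ≤ j → j + 1 ≤ i → 1 ≤ w j + w (j + 1)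

/-- The values of `Q i` over the admissible weights with `w i = x`. -/
def prefixValues (d : ℕ → ℝ) (i : ℕ) (x : ℝ) : Set ℝ :=
  {q | ∃ w : ℕ → ℝ, PrefixFeasible i w ∧ w i = x ∧ q = partialQ d i w}

/-- The function `x ↦ Q i (x)`: the minimum of `Q i` over the admissible weights with
`w i = x`. -/
noncomputable def minQ (d : ℕ → ℝ) (i : ℕ) (x : ℝ) : ℝ := sInf (prefixValues d i x)

/-- The function `R i`: the derivative of `x ↦ Q i (x)` on `[0, ∞)` (one-sided at `0`). -/
noncomputable def derivQ (d : ℕ → ℝ) (i : ℕ) (x : ℝ) : ℝ := derivWithin (minQ d i) (Set.Ici 0) x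

/-- The functions `Q i` and `R i` are what their definitions intend: the minimum is attained, the
derivative exists, and `R i` has an inverse defined at all `y ≥ 0`. -/
structure WellDefined (d : ℕ → ℝ) (i : ℕ) : Prop where
  isLeast : ∀ x, 0 ≤ x → IsLeast (prefixValues d i x) (minQ d i x)
  differentiable : DifferentiableOn ℝ (minQ d i) (Set.Ici 0)
  strictMono : StrictMonoOn (derivQ d i) (Set.Ici 0)
  existsUnique : ∀ y, 0 ≤ y → ∃! x, 0 ≤ x ∧ derivQ d i x = y

/-- `x` is the value at `y` of the inverse function of `R i` on `[0, ∞)`. -/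
def IsInvR (d : ℕ → ℝ) (i : ℕ) (y x : ℝ) : Prop := 0 ≤ x ∧ derivQ d i x = y

/-- The back-substitution formulas for the weights `w 1, …, w (n - 1)`. -/
structure BackSubstitution (n : ℕ) (d w : ℕ → ℝ) : Prop where
  two : n = 2 → w 1 = 1
  last : 3 ≤ n → ∃ u, IsInvR d (n - 1) 0 u ∧ w (n - 1) = max u 1
  middle : ∀ i, 2 ≤ i → i + 2 ≤ n →
    ∃ u, IsInvR d i (xi d i * w (i + 1)) u ∧ w i = max u (1 - w (i + 1))
  first : 3 ≤ n → w 1 = max (d 2 / (2 * d 1) * w 2) 1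

/-! ### The implicit representation -/

/-- The matrix `M (i + 1)`. -/
noncomputable def matM (d : ℕ → ℝ) (i : ℕ) : Matrix (Fin 3) (Fin 3) ℝ :=
  !![0, 1 / xi d i, 0;
     -xi d i, 4 * d (i + 1) ^ 2 / xi d i, 0;
     0, 0, 1]

/-- The matrix `L (i + 1)`. -/
def matL (d : ℕ → ℝ) (i : ℕ) : Matrix (Fin 3) (Fin 3) ℝ :=
  !![-1, 0, 1;
     -2 * xi d i - 4 * d (i + 1) ^ 2, -1, xi d i + 4 * d (i + 1) ^ 2;
     0, 0, 1]

/-- The point of the graph of `R (i + 1)` at `x` is the image under `A` of a point of the graph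
of `R i`. -/
def Transfers (d : ℕ → ℝ) (i : ℕ) (A : Matrix (Fin 3) (Fin 3) ℝ) (x : ℝ) : Prop :=
  ∃ x₀ : ℝ, 0 ≤ x₀ ∧ ![x, derivQ d (i + 1) x, 1] = A.mulVec ![x₀, derivQ d i x₀, 1]

/-! ### Real random access machines

A state has index registers (natural numbers), real registers, and arrays of real numbers
that are addressed through index registers. The names of registers and arrays are constants of the
program, so that a program uses finitely many of them. The index arithmetic is limited to addition
and truncated subtraction, the real arithmetic to the four operations with integer constants;
there is no rounding and no conversion between real numbers and indices. Every instruction and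
every test costs one step. -/

/-- A state of the machine: index registers, real registers, arrays of real numbers. -/
structure State where
  idx : ℕ → ℕ
  reg : ℕ → ℝ
  mem : ℕ → ℕ → ℝ

/-- The elementary instructions. The first argument names the register that is assigned; in `load`
and `store`, `A` names the array and `a` the index register that holds the position. -/
inductive Instr where
  | idxConst (a : ℕ) (c : ℕ)
  | idxCopy (a b : ℕ)
  | idxAdd (a b c : ℕ)
  | idxSub (a b c : ℕ)
  | realConst (r : ℕ) (c : ℤ)
  | realCopy (r x : ℕ)
  | realAdd (r x y : ℕ)
  | realSub (r x y : ℕ)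
  | realMul (r x y : ℕ)
  | realDiv (r x y : ℕ)
  | load (r A a : ℕ)
  | store (A a r : ℕ)

namespace State

/-- Assign `v` to the index register `a`. -/
def setIdx (s : State) (a v : ℕ) : State := { s with idx := Function.update s.idx a v }

/-- Assign `v` to the real register `r`. -/
def setReg (s : State) (r : ℕ) (v : ℝ) : State := { s with reg := Function.update s.reg r v }

/-- Assign `v` to position `k` of the array `A`. -/
def setMem (s : State) (A k : ℕ) (v : ℝ) : State :=
  { s with mem := Function.update s.mem A (Function.update (s.mem A) k v) }

end State

open Classical in
/-- The effect of an instruction; a division by zero has no result. -/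
noncomputable def Instr.step (s : State) : Instr → Option State
  | .idxConst a c => some (s.setIdx a c)
  | .idxCopy a b => some (s.setIdx a (s.idx b))
  | .idxAdd a b c => some (s.setIdx a (s.idx b + s.idx c))
  | .idxSub a b c => some (s.setIdx a (s.idx b - s.idx c))
  | .realConst r c => some (s.setReg r (c : ℝ))
  | .realCopy r x => some (s.setReg r (s.reg x))
  | .realAdd r x y => some (s.setReg r (s.reg x + s.reg y))
  | .realSub r x y => some (s.setReg r (s.reg x - s.reg y))
  | .realMul r x y => some (s.setReg r (s.reg x * s.reg y))
  | .realDiv r x y => if s.reg y = 0 then none else some (s.setReg r (s.reg x / s.reg y))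
  | .load r A a => some (s.setReg r (s.mem A (s.idx a)))
  | .store A a r => some (s.setMem A (s.idx a) (s.reg r))

/-- The elementary tests. -/
inductive Test where
  | idxLt (a b : ℕ)
  | idxLe (a b : ℕ)
  | realLt (x y : ℕ)
  | realLe (x y : ℕ)

/-- The truth of a test in a state. -/
def Test.Holds (s : State) : Test → Prop
  | .idxLt a b => s.idx a < s.idx b
  | .idxLe a b => s.idx a ≤ s.idx b
  | .realLt x y => s.reg x < s.reg y
  | .realLe x y => s.reg x ≤ s.reg y

/-- Programs. -/
inductive Prog where
  | skip
  | instr (c : Instr)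
  | seq (P Q : Prog)
  | ite (b : Test) (P Q : Prog)
  | loop (b : Test) (P : Prog)

/-- `Exec P s t s'`: started in the state `s`, the program `P` halts in the state `s'` after `t`
steps. `Prog.loop b P` repeats `P` as long as the test `b` holds. -/
inductive Exec : Prog → State → ℕ → State → Prop where
  | skip (s : State) : Exec Prog.skip s 1 s
  | instr {c : Instr} {s s' : State} (h : c.step s = some s') : Exec (Prog.instr c) s 1 s'
  | seq {P Q : Prog} {s s' s'' : State} {t t' : ℕ} (h : Exec P s t s') (h' : Exec Q s' t' s'') :
      Exec (Prog.seq P Q) s (t + t') s''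
  | iteTrue {b : Test} {P Q : Prog} {s s' : State} {t : ℕ} (hb : b.Holds s) (h : Exec P s t s') :
      Exec (Prog.ite b P Q) s (1 + t) s'
  | iteFalse {b : Test} {P Q : Prog} {s s' : State} {t : ℕ} (hb : ¬ b.Holds s)
      (h : Exec Q s t s') : Exec (Prog.ite b P Q) s (1 + t) s'
  | loopTrue {b : Test} {P : Prog} {s s' s'' : State} {t t' : ℕ} (hb : b.Holds s)
      (h : Exec P s t s') (h' : Exec (Prog.loop b P) s' t' s'') :
      Exec (Prog.loop b P) s (1 + t + t') s''
  | loopFalse {b : Test} {P : Prog} {s : State} (hb : ¬ b.Holds s) :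
      Exec (Prog.loop b P) s 1 s

/-- The initial state on the input `p 1, …, p n`: index register `0` holds `n`, position `i` of
array `0` holds `p i`, everything else is zero. -/
noncomputable def inputState (n : ℕ) (p : ℕ → ℝ) : State where
  idx := Function.update (fun _ => 0) 0 n
  reg := fun _ => 0
  mem := fun A i => if A = 0 ∧ 1 ≤ i ∧ i ≤ n then p i else 0

/-! ### Where the machine leaves its results

Array `1` holds the weights, position `i` of arrays `2`, `3`, `4`, `5, …, 13` and `14, …, 22` holds
the record of `R i`, and array `23` holds the coefficients of the two pieces of `R 2`. -/

/-- The weights that were computed. -/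
def State.weight (s : State) (i : ℕ) : ℝ := s.mem 1 i

/-- Whether a breakpoint is stored for `R i` (`1`) or not (`0`). -/
def State.flag (s : State) (i : ℕ) : ℝ := s.mem 2 i

/-- The first coordinate of the stored breakpoint of `R i`. -/
def State.breakX (s : State) (i : ℕ) : ℝ := s.mem 3 i

/-- The second coordinate of the stored breakpoint of `R i`. -/
def State.breakY (s : State) (i : ℕ) : ℝ := s.mem 4 i

/-- The first matrix stored for `R i`, row by row. -/
def State.storedL (s : State) (i : ℕ) : Matrix (Fin 3) (Fin 3) ℝ :=
  Matrix.of fun a b => s.mem (5 + 3 * (a : ℕ) + (b : ℕ)) i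

/-- The second matrix stored for `R i`, row by row. -/
def State.storedM (s : State) (i : ℕ) : Matrix (Fin 3) (Fin 3) ℝ :=
  Matrix.of fun a b => s.mem (14 + 3 * (a : ℕ) + (b : ℕ)) i

/-- `R 2` is stored explicitly: its breakpoint and its two linear pieces. -/
structure StoresFirst (d : ℕ → ℝ) (s : State) : Prop where
  pos : 0 < s.breakX 2
  breakY_eq : s.breakY 2 = derivQ d 2 (s.breakX 2)
  below : ∀ x, 0 ≤ x → x ≤ s.breakX 2 → derivQ d 2 x = s.mem 23 0 * x + s.mem 23 1
  above : ∀ x, s.breakX 2 ≤ x → derivQ d 2 x = s.mem 23 2 * x + s.mem 23 3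

/-- `R (i + 1)` is stored implicitly, relative to `R i`: either it has no breakpoint (this is the
case in which the zero of `R i` is at least `1`), and the stored matrix `M (i + 1)` carries the
graph of `R i` to the graph of `R (i + 1)`; or a breakpoint is stored, and the stored matrices
`L (i + 1)` and `M (i + 1)` do this below and above the breakpoint. -/
def StoresNext (d : ℕ → ℝ) (s : State) (i : ℕ) : Prop :=
  s.storedM (i + 1) = matM d i ∧
    (((∃ u, 1 ≤ u ∧ IsInvR d i 0 u) ∧ s.flag (i + 1) = 0 ∧
        ∀ x, 0 ≤ x → Transfers d i (s.storedM (i + 1)) x) ∨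
      ((∃ u, u < 1 ∧ IsInvR d i 0 u) ∧ s.flag (i + 1) = 1 ∧
        s.storedL (i + 1) = matL d i ∧
        0 < s.breakX (i + 1) ∧ s.breakX (i + 1) < 1 ∧
        s.breakY (i + 1) = derivQ d (i + 1) (s.breakX (i + 1)) ∧
        (∀ x, 0 ≤ x → x ≤ s.breakX (i + 1) → Transfers d i (s.storedL (i + 1)) x) ∧
        ∀ x, s.breakX (i + 1) ≤ x → Transfers d i (s.storedM (i + 1)) x))

end DKS

namespace DKS
open Set

/-! ### Convex functions with a continuous subgradient -/

/-! Reduction to a chain. Given admissible weights, let F_i be the sum of w_ab (p_b - p_a) over the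
pairs a ≤ i < b. By symmetry the signed residuals of the points 1, ..., i add up to F_i, so the
residuals are differences of consecutive F_i, and replacing all weights by F_i / d_i on the
consecutive pairs does not change Q. A pair that crosses the gap i spans it, so F_i / d_i is at
least the total weight across the gap, and admissibility survives
(`exists_prefixFeasible_of_feasible`). Conversely, feasible chain weights with last weight at least
1 are admissible.

Dynamic program. On a chain, Q_{i+1}(x) is the minimum of Q_i(z) - ξ_i x z + 2 d_{i+1}² x² over z ≥
0 with z ≥ 1 - x. If Q_i is strongly convex with derivative R_i, the minimizer is g = max(R_i⁻¹(ξ_i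
x), 1 - x), and λ = R_i(g) - ξ_i x is the multiplier of x + z ≥ 1. Completing a square shows that 4
d_{i+1}² x - ξ_i g - λ is a subgradient of Q_{i+1} and that strong convexity persists, with modulus
d_{i+1}² (`Regular.succ`). The formula for g is the back-substitution formula, and these weights are
optimal (`BackSubstitution.isOptimal`).

Representation. If λ = 0, the formula for R_{i+1} is the linear map M_{i+1} applied to (g, R_i(g),
1); if g = 1 - x, it is L_{i+1}. The cases switch where the graph of R_i meets the line ξ_i x + y =
ξ_i (`Regular.breakpoint`).

Algorithm. Zeros, breakpoints and inverse values of R_i are all intersections of its graph with a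
line. The line is pulled back through M or L, level by level, to the explicit R_2, together with a
functional that remembers the original abscissa (`Meets.pullM`, `Meets.pullL`). The slope bound for
R_i makes the side of a breakpoint readable from one sign. An intersection thus costs O(i), and
linearly many of them are needed. The remaining work is a small calculus of programs with step
bounds, culminating in `optimalWeights_runs`. -/

theorem hasDerivWithinAt_of_subgradient {S : Set ℝ} {f r : ℝ → ℝ}
    (h : ∀ x ∈ S, ∀ y ∈ S, f x + r x * (y - x) ≤ f y) (hr : ContinuousOn r S) {x : ℝ}
    (hx : x ∈ S) : HasDerivWithinAt f (r x) S x := by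
  rw [hasDerivWithinAt_iff_isLittleO, Asymptotics.isLittleO_iff]
  intro c hc
  have h1 := Metric.tendsto_nhds.1 (hr x hx) c hc
  filter_upwards [h1, self_mem_nhdsWithin] with y hy hyS
  rw [Real.dist_eq] at hy
  have hlow := h x hx y hyS
  have hup := h y hyS x hx
  -- The subgradient inequalities at x and at y squeeze the linearization error between 0 and (r y -
  -- r x)(y - x), which is o(y - x) because r is continuous.
  have hle : |f y - f x - (y - x) * r x| ≤ |(r y - r x) * (y - x)| := by
    rw [abs_of_nonneg (by linarith)]
    exact le_trans (by nlinarith) (le_abs_self _)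
  rw [smul_eq_mul, Real.norm_eq_abs, Real.norm_eq_abs]
  rw [abs_mul] at hle
  exact hle.trans (mul_le_mul_of_nonneg_right hy.le (abs_nonneg _))

/-- The properties of `Q i` and `R i` that are carried from `i` to `i + 1`: the minimum is
attained, `Q i` is strongly convex with subgradient `R i`, and `R i` is continuous and negative
at `0`. -/
structure Regular (d : ℕ → ℝ) (i : ℕ) : Prop where
  isLeast : ∀ x, 0 ≤ x → IsLeast (prefixValues d i x) (minQ d i x)
  lower : ∀ x y, 0 ≤ x → 0 ≤ y →
    minQ d i x + derivQ d i x * (y - x) + d i ^ 2 * (y - x) ^ 2 ≤ minQ d i y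
  cont : ContinuousOn (derivQ d i) (Ici 0)
  zero_neg : derivQ d i 0 < 0

/-- Once a candidate minimum q and a candidate subgradient r are exhibited, the infimum and the
derivative in the definitions are forced. Both the base case and the induction step only have to
supply q and r. -/
theorem regular_of_explicit {d : ℕ → ℝ} {i : ℕ} {q r : ℝ → ℝ}
    (hq : ∀ x, 0 ≤ x → IsLeast (prefixValues d i x) (q x))
    (hl : ∀ x y, 0 ≤ x → 0 ≤ y → q x + r x * (y - x) + d i ^ 2 * (y - x) ^ 2 ≤ q y)
    (hr : ContinuousOn r (Ici 0)) (h0 : r 0 < 0) :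
    Regular d i ∧ ∀ x, 0 ≤ x → minQ d i x = q x ∧ derivQ d i x = r x := by
  have hQ : ∀ x, 0 ≤ x → minQ d i x = q x := fun x hx => (hq x hx).csInf_eq
  have hR : ∀ x, 0 ≤ x → derivQ d i x = r x := by
    intro x hx
    have hsub : HasDerivWithinAt q (r x) (Ici 0) x := by
      refine hasDerivWithinAt_of_subgradient (fun a ha b hb => ?_) hr hx
      have := hl a b ha hb
      nlinarith [mul_nonneg (sq_nonneg (d i)) (sq_nonneg (b - a))]
    exact (hsub.congr (fun y hy => hQ y hy) (hQ x hx)).derivWithin (uniqueDiffOn_Ici 0 x hx)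
  refine ⟨⟨fun x hx => ?_, fun x y hx hy => ?_, hr.congr fun x hx => hR x hx, ?_⟩,
    fun x hx => ⟨hQ x hx, hR x hx⟩⟩
  · rw [hQ x hx]; exact hq x hx
  · rw [hQ x hx, hQ y hy, hR x hx]; exact hl x y hx hy
  · rw [hR 0 le_rfl]; exact h0

namespace Regular

variable {d : ℕ → ℝ} {i : ℕ}

/-- Add the strong convexity inequalities at x and at y. This bound gives strict monotonicity, the
inverse of R_i and its Lipschitz continuity, and it later decides which lines meet the graph only
once. -/
theorem slope (h : Regular d i) {x y : ℝ} (hx : 0 ≤ x) (hxy : x ≤ y) :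
    2 * d i ^ 2 * (y - x) ≤ derivQ d i y - derivQ d i x := by
  rcases hxy.eq_or_lt with rfl | hlt
  · simp
  have h1 := h.lower x y hx (hx.trans hxy)
  have h2 := h.lower y x (hx.trans hxy) hx
  have h3 : (2 * d i ^ 2 * (y - x)) * (y - x) ≤ (derivQ d i y - derivQ d i x) * (y - x) := by
    nlinarith
  exact le_of_mul_le_mul_right h3 (by linarith)

theorem strictMonoOn (h : Regular d i) (hd : 0 < d i) : StrictMonoOn (derivQ d i) (Ici 0) := by
  intro x hx y _ hxy
  have := h.slope hx hxy.le
  have : 0 < 2 * d i ^ 2 * (y - x) := by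
    have := sub_pos.2 hxy
    positivity
  linarith

theorem exists_isInvR (h : Regular d i) (hd : 0 < d i) {y : ℝ} (hy : 0 ≤ y) :
    ∃ x, IsInvR d i y x := by
  have h0 := h.zero_neg
  -- At this point the linear lower bound for R_i given by `slope` reaches y.
  set X := (y - derivQ d i 0) / (2 * d i ^ 2) with hX
  have hX0 : 0 ≤ X := div_nonneg (by linarith) (by positivity)
  have hXy : y ≤ derivQ d i X := by
    have h1 := h.slope le_rfl hX0
    have h2 : 2 * d i ^ 2 * (X - 0) = y - derivQ d i 0 := by
      rw [hX]; field_simp; ring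
    linarith
  obtain ⟨x, hx, hxy⟩ := intermediate_value_Icc hX0
    (h.cont.mono fun a ha => ha.1) (show y ∈ Icc _ _ from ⟨by linarith, hXy⟩)
  exact ⟨x, hx.1, hxy⟩

theorem isInvR_unique (h : Regular d i) (hd : 0 < d i) {y x x' : ℝ} (hx : IsInvR d i y x)
    (hx' : IsInvR d i y x') : x = x' :=
  (h.strictMonoOn hd).injOn hx.1 hx'.1 (hx.2.trans hx'.2.symm)

theorem wellDefined (h : Regular d i) (hd : 0 < d i) : WellDefined d i where
  isLeast := h.isLeast
  differentiable := by
    intro x hx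
    refine (hasDerivWithinAt_of_subgradient (fun a ha b hb => ?_) h.cont hx).differentiableWithinAt
    have := h.lower a b ha hb
    nlinarith [mul_nonneg (sq_nonneg (d i)) (sq_nonneg (b - a))]
  strictMono := h.strictMonoOn hd
  existsUnique := by
    intro y hy
    obtain ⟨x, hx⟩ := h.exists_isInvR hd hy
    exact ⟨x, hx, fun x' hx' => h.isInvR_unique hd hx' hx⟩

end Regular

/-! ### The recursion for the partial quality measures -/

/-- The end term d_i² w_i² cancels against the new square, so the old and the new last weights are
coupled only through their product. -/
theorem partialQ_succ (d : ℕ → ℝ) {i : ℕ} (hi : 1 ≤ i) (w : ℕ → ℝ) :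
    partialQ d (i + 1) w
      = partialQ d i w - xi d i * (w (i + 1) * w i) + 2 * d (i + 1) ^ 2 * w (i + 1) ^ 2 := by
  unfold partialQ xi
  rw [Finset.sum_Icc_succ_top (by omega)]
  simp only [Nat.add_sub_cancel]
  ring

theorem partialQ_congr (d : ℕ → ℝ) {i : ℕ} (hi : 1 ≤ i) {w w' : ℕ → ℝ}
    (h : ∀ j, 1 ≤ j → j ≤ i → w j = w' j) : partialQ d i w = partialQ d i w' := by
  unfold partialQ
  rw [h i hi le_rfl, h 1 le_rfl hi]
  congr 1
  refine Finset.sum_congr rfl fun j hj => ?_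
  rw [Finset.mem_Icc] at hj
  rw [h j (by omega) hj.2, h (j - 1) (by omega) (by omega)]

theorem PrefixFeasible.congr {i : ℕ} (hi : 1 ≤ i) {w w' : ℕ → ℝ} (hw : PrefixFeasible i w)
    (h : ∀ j, 1 ≤ j → j ≤ i → w j = w' j) : PrefixFeasible i w' where
  nonneg j h1 h2 := h j h1 h2 ▸ hw.nonneg j h1 h2
  one_le_first := h 1 le_rfl hi ▸ hw.one_le_first
  one_le_add j h1 h2 := by
    rw [← h j (by omega) (by omega), ← h (j + 1) (by omega) h2]
    exact hw.one_le_add j h1 h2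

theorem prefixFeasible_succ {i : ℕ} (hi : 2 ≤ i) (w : ℕ → ℝ) :
    PrefixFeasible (i + 1) w ↔ PrefixFeasible i w ∧ 0 ≤ w (i + 1) ∧ 1 ≤ w i + w (i + 1) := by
  constructor
  · intro h
    exact ⟨⟨fun j h1 h2 => h.nonneg j h1 (by omega), h.one_le_first,
      fun j h1 h2 => h.one_le_add j h1 (by omega)⟩, h.nonneg _ (by omega) le_rfl,
      h.one_le_add i hi le_rfl⟩
  · rintro ⟨h, h1, h2⟩
    refine ⟨fun j hj hj' => ?_, h.one_le_first, fun j hj hj' => ?_⟩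
    · rcases hj'.eq_or_lt with rfl | hlt
      · exact h1
      · exact h.nonneg j hj (by omega)
    · rcases hj'.eq_or_lt with he | hlt
      · obtain rfl : j = i := by omega
        exact h2
      · exact h.one_le_add j hj (by omega)

theorem prefixFeasible_two (w : ℕ → ℝ) : PrefixFeasible 2 w ↔ 1 ≤ w 1 ∧ 0 ≤ w 2 := by
  constructor
  · intro h
    exact ⟨h.one_le_first, h.nonneg 2 (by omega) le_rfl⟩
  · rintro ⟨h1, h2⟩
    refine ⟨fun j hj hj' => ?_, h1, fun j hj hj' => by omega⟩
    obtain rfl | rfl : j = 1 ∨ j = 2 := by omega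
    · linarith
    · exact h2

theorem partialQ_one (d w : ℕ → ℝ) : partialQ d 1 w = 2 * d 1 ^ 2 * w 1 ^ 2 := by
  simp [partialQ]; ring

theorem partialQ_two (d w : ℕ → ℝ) :
    partialQ d 2 w = 2 * d 1 ^ 2 * w 1 ^ 2 - xi d 1 * (w 2 * w 1) + 2 * d 2 ^ 2 * w 2 ^ 2 := by
  rw [partialQ_succ d le_rfl, partialQ_one]

/-- `Q 2` and `R 2` in terms of the optimal first weight. -/
theorem regular_two {d : ℕ → ℝ} (h1 : 0 < d 1) (h2 : 0 < d 2) :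
    Regular d 2 ∧ ∀ x, 0 ≤ x → ∀ g, g = max (d 2 / (2 * d 1) * x) 1 →
      minQ d 2 x = 2 * d 1 ^ 2 * g ^ 2 - xi d 1 * (x * g) + 2 * d 2 ^ 2 * x ^ 2 ∧
      derivQ d 2 x = 4 * d 2 ^ 2 * x - xi d 1 * g := by
  set g : ℝ → ℝ := fun x => max (d 2 / (2 * d 1) * x) 1 with hg
  have hg1 : ∀ x, 1 ≤ g x := fun x => le_max_right _ _
  have hgl : ∀ x, 2 * d 2 * d 1 * x ≤ 4 * d 1 ^ 2 * g x := by
    intro x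
    have : d 2 / (2 * d 1) * x ≤ g x := le_max_left _ _
    have h3 := mul_le_mul_of_nonneg_left this (show 0 ≤ 4 * d 1 ^ 2 by positivity)
    have h4 : 4 * d 1 ^ 2 * (d 2 / (2 * d 1) * x) = 2 * d 2 * d 1 * x := by field_simp; ring
    linarith
  have hge : ∀ x, (4 * d 1 ^ 2 * g x - 2 * d 2 * d 1 * x) * (g x - 1) = 0 := by
    intro x
    rcases max_choice (d 2 / (2 * d 1) * x) 1 with h | h
    · have : g x = d 2 / (2 * d 1) * x := h
      rw [this]; field_simp; ring
    · have : g x = 1 := h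
      rw [this]; ring
  have key : ∀ x, 0 ≤ x → ∀ y v : ℝ, 1 ≤ v →
      2 * d 1 ^ 2 * g x ^ 2 - xi d 1 * (x * g x) + 2 * d 2 ^ 2 * x ^ 2
        + (4 * d 2 ^ 2 * x - xi d 1 * g x) * (y - x) + d 2 ^ 2 * (y - x) ^ 2
      ≤ 2 * d 1 ^ 2 * v ^ 2 - xi d 1 * (y * v) + 2 * d 2 ^ 2 * y ^ 2 := by
    intro x _ y v hv
    have e1 := hge x
    have e2 := mul_nonneg (sub_nonneg.2 (hgl x)) (sub_nonneg.2 hv)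
    unfold xi
    -- The second-order remainder, less the claimed d_2² (y - x)², is exactly the sum of these two
    -- squares; e1 and e2 are complementary slackness and the first-order condition for the
    -- constraint v ≥ 1.
    nlinarith [sq_nonneg (d 1 * (v - g x) - d 2 * (y - x)), sq_nonneg (d 1 * (v - g x))]
  have main := regular_of_explicit (d := d) (i := 2)
    (q := fun x => 2 * d 1 ^ 2 * g x ^ 2 - xi d 1 * (x * g x) + 2 * d 2 ^ 2 * x ^ 2)
    (r := fun x => 4 * d 2 ^ 2 * x - xi d 1 * g x) ?_ ?_ ?_ ?_
  · refine ⟨main.1, fun x hx v hv => ?_⟩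
    subst hv
    exact main.2 x hx
  · intro x hx
    constructor
    · refine ⟨fun j => if j = 1 then g x else x, ?_, by simp, ?_⟩
      · rw [prefixFeasible_two]
        simpa using ⟨hg1 x, hx⟩
      · rw [partialQ_two]; simp
    · rintro q ⟨w, hw, rfl, rfl⟩
      rw [prefixFeasible_two] at hw
      rw [partialQ_two]
      have := key (w 2) hx (w 2) (w 1) hw.1
      simpa using this
  · intro x y hx hy
    exact key x hx y (g y) (hg1 y)
  · exact Continuous.continuousOn (by fun_prop)
  · have : g 0 = 1 := by simp [hg]
    simp only [this, xi]
    nlinarith [mul_pos h1 h2]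

/-- `Q (i + 1)` and `R (i + 1)` in terms of the optimal weight before the last. -/
theorem Regular.succ {d : ℕ → ℝ} {i : ℕ} (hi : 2 ≤ i) (h : Regular d i) (hd : 0 < d i)
    (hd' : 0 < d (i + 1)) :
    Regular d (i + 1) ∧ ∀ x, 0 ≤ x → ∀ u, IsInvR d i (xi d i * x) u → ∀ g, g = max u (1 - x) →
      minQ d (i + 1) x = minQ d i g - xi d i * (x * g) + 2 * d (i + 1) ^ 2 * x ^ 2 ∧
      derivQ d (i + 1) x
        = 4 * d (i + 1) ^ 2 * x - xi d i * g - (derivQ d i g - xi d i * x) := by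
  have hxi : 0 < xi d i := by unfold xi; positivity
  have hex : ∀ y, 0 ≤ y → ∃ x, IsInvR d i y x := fun y hy => h.exists_isInvR hd hy
  choose! v hv using hex
  set g : ℝ → ℝ := fun x => max (v (xi d i * x)) (1 - x) with hg
  have hvx : ∀ x, 0 ≤ x → IsInvR d i (xi d i * x) (v (xi d i * x)) :=
    fun x hx => hv _ (by positivity)
  have hg0 : ∀ x, 0 ≤ x → 0 ≤ g x := fun x hx => (hvx x hx).1.trans (le_max_left _ _)
  have hg1 : ∀ x, 1 ≤ x + g x := fun x => by
    have : 1 - x ≤ g x := le_max_right _ _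
    linarith
  -- Sign of the multiplier of the constraint x + z ≥ 1; `hcomp` is complementary slackness.
  have hlam : ∀ x, 0 ≤ x → 0 ≤ derivQ d i (g x) - xi d i * x := by
    intro x hx
    have := h.slope (hvx x hx).1 (le_max_left (v (xi d i * x)) (1 - x))
    rw [(hvx x hx).2] at this
    have h2 : 0 ≤ 2 * d i ^ 2 * (max (v (xi d i * x)) (1 - x) - v (xi d i * x)) :=
      mul_nonneg (by positivity) (sub_nonneg.2 (le_max_left _ _))
    exact h2.trans this
  have hcomp : ∀ x, 0 ≤ x → (derivQ d i (g x) - xi d i * x) * (x + g x - 1) = 0 := by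
    intro x hx
    rcases max_choice (v (xi d i * x)) (1 - x) with hm | hm
    · have : g x = v (xi d i * x) := hm
      rw [this, (hvx x hx).2]; ring
    · have : g x = 1 - x := hm
      rw [this]; ring
  have key : ∀ x, 0 ≤ x → ∀ y z : ℝ, 0 ≤ z → 1 ≤ y + z →
      minQ d i (g x) - xi d i * (x * g x) + 2 * d (i + 1) ^ 2 * x ^ 2
        + (4 * d (i + 1) ^ 2 * x - xi d i * g x - (derivQ d i (g x) - xi d i * x)) * (y - x)
        + d (i + 1) ^ 2 * (y - x) ^ 2
      ≤ minQ d i z - xi d i * (y * z) + 2 * d (i + 1) ^ 2 * y ^ 2 := by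
    intro x hx y z hz hyz
    have e0 := h.lower (g x) z (hg0 x hx) hz
    have e1 := hcomp x hx
    have e2 := mul_nonneg (hlam x hx) (sub_nonneg.2 hyz)
    have e3 := sq_nonneg (d i * (z - g x) - d (i + 1) * (y - x))
    unfold xi at *
    -- After the multiplier terms, the remainder is at least d_i² (z - g)² - ξ_i (y - x)(z - g) + 2
    -- d_{i+1}² (y - x)², which is the square e3 plus d_{i+1}² (y - x)². The leftover is the modulus
    -- for i + 1.
    nlinarith
  -- The slope of R_i is at least 2 d_i², so its inverse is Lipschitz with the reciprocal constant.
  have vcont : ContinuousOn v (Ici 0) := by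
    have hlip : ∀ a b, 0 ≤ a → 0 ≤ b → v a ≤ v b → v b - v a ≤ (2 * d i ^ 2)⁻¹ * |b - a| := by
      intro a b ha hb hab
      have h1 := h.slope (hv a ha).1 hab
      rw [(hv a ha).2, (hv b hb).2] at h1
      rw [inv_mul_eq_div, le_div_iff₀ (by positivity)]
      have := le_abs_self (b - a)
      nlinarith
    refine (LipschitzOnWith.of_dist_le_mul (K := ⟨(2 * d i ^ 2)⁻¹, by positivity⟩)
      fun a ha b hb => ?_).continuousOn
    rw [Real.dist_eq, Real.dist_eq]
    change _ ≤ (2 * d i ^ 2)⁻¹ * _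
    rcases le_total (v a) (v b) with hab | hab
    · rw [abs_sub_comm, abs_of_nonneg (by linarith), abs_sub_comm]
      exact hlip a b ha hb hab
    · rw [abs_of_nonneg (by linarith)]
      exact hlip b a hb ha hab
  have gcont : ContinuousOn g (Ici 0) := by
    refine ContinuousOn.sup (vcont.comp (by fun_prop) fun x hx => ?_) (by fun_prop)
    exact mul_nonneg hxi.le hx
  have main := regular_of_explicit (d := d) (i := i + 1)
    (q := fun x => minQ d i (g x) - xi d i * (x * g x) + 2 * d (i + 1) ^ 2 * x ^ 2)
    (r := fun x => 4 * d (i + 1) ^ 2 * x - xi d i * g x - (derivQ d i (g x) - xi d i * x))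
    ?_ ?_ ?_ ?_
  · refine ⟨main.1, fun x hx u hu z hz => ?_⟩
    obtain rfl : u = v (xi d i * x) := h.isInvR_unique hd hu (hvx x hx)
    subst hz
    exact main.2 x hx
  · intro x hx
    constructor
    · obtain ⟨w, hw, hwx, hwq⟩ := (h.isLeast (g x) (hg0 x hx)).1
      have hcongr : ∀ j, 1 ≤ j → j ≤ i → w j = Function.update w (i + 1) x j := by
        intro j _ hj
        rw [Function.update_of_ne (by omega)]
      refine ⟨Function.update w (i + 1) x, ?_, by simp, ?_⟩
      · rw [prefixFeasible_succ hi]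
        refine ⟨hw.congr (by omega) hcongr, by simpa using hx, ?_⟩
        rw [← hcongr i (by omega) le_rfl, hwx, Function.update_self]
        linarith [hg1 x]
      · rw [partialQ_succ d (by omega), ← partialQ_congr d (by omega) hcongr,
          ← hcongr i (by omega) le_rfl, hwx, Function.update_self, hwq]
    · rintro q ⟨w, hw, rfl, rfl⟩
      rw [prefixFeasible_succ hi] at hw
      obtain ⟨hw, _, hw2⟩ := hw
      have hwi := hw.nonneg i (by omega) le_rfl
      rw [partialQ_succ d (by omega)]
      have e1 := key (w (i + 1)) hx (w (i + 1)) (w i) hwi (by linarith)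
      have e2 := (h.isLeast (w i) hwi).2 ⟨w, hw, rfl, rfl⟩
      simp only [sub_self, mul_zero, add_zero, ne_eq, OfNat.ofNat_ne_zero, not_false_eq_true,
        zero_pow] at e1
      linarith
  · intro x y hx hy
    exact key x hx y (g y) (hg0 y hy) (hg1 y)
  · have := h.cont.comp gcont fun x hx => hg0 x hx
    have h2 : ContinuousOn (fun x => derivQ d i (g x)) (Ici 0) := this
    fun_prop
  · have h1 := hlam 0 le_rfl
    have h2 := hg1 0
    simp only [mul_zero, zero_sub, sub_zero, zero_add] at *
    nlinarith

theorem regular {d : ℕ → ℝ} {i : ℕ} (hi : 2 ≤ i) (hd : ∀ j, 1 ≤ j → j ≤ i → 0 < d j) :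
    Regular d i := by
  induction i, hi using Nat.le_induction with
  | base => exact (regular_two (hd 1 le_rfl (by omega)) (hd 2 (by omega) le_rfl)).1
  | succ i hi ih =>
    exact (Regular.succ hi (ih fun j h1 h2 => hd j h1 (by omega)) (hd i (by omega) (by omega))
      (hd (i + 1) (by omega) le_rfl)).1

end DKS

namespace DKS
open Set

/-! ### Reduction to weights on consecutive pairs -/

/-- The flow across the gap between the points `i` and `i + 1`. -/
def flow (n : ℕ) (p : ℕ → ℝ) (W : ℕ → ℕ → ℝ) (i : ℕ) : ℝ :=
  ∑ a ∈ Finset.Icc 1 i, ∑ b ∈ Finset.Icc (i + 1) n, W a b * (p b - p a)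

theorem sum_Icc_split {M : Type*} [AddCommMonoid M] (f : ℕ → M) {i n : ℕ} (hi : i ≤ n) :
    ∑ j ∈ Finset.Icc 1 n, f j = ∑ j ∈ Finset.Icc 1 i, f j + ∑ j ∈ Finset.Icc (i + 1) n, f j := by
  rw [← Finset.sum_union]
  · congr 1
    ext j
    simp only [Finset.mem_Icc, Finset.mem_union]
    omega
  · rw [Finset.disjoint_left]
    intro j hj hj'
    rw [Finset.mem_Icc] at hj hj'
    omega

/-- Contributions of pairs inside {1, ..., i} are antisymmetric and cancel; only the pairs across
the gap remain. -/
theorem sum_resid {n : ℕ} (p : ℕ → ℝ) {W : ℕ → ℕ → ℝ}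
    (hW : ∀ i ∈ Finset.Icc 1 n, ∀ j ∈ Finset.Icc 1 n, W i j = W j i) {i : ℕ} (hi : i ≤ n) :
    ∑ a ∈ Finset.Icc 1 i, resid n p W a = flow n p W i := by
  have hsub : ∀ a ∈ Finset.Icc 1 i, a ∈ Finset.Icc 1 n := by
    intro a ha
    rw [Finset.mem_Icc] at *
    omega
  have hanti : ∑ a ∈ Finset.Icc 1 i, ∑ b ∈ Finset.Icc 1 i, W a b * (p b - p a)
      = -∑ a ∈ Finset.Icc 1 i, ∑ b ∈ Finset.Icc 1 i, W a b * (p b - p a) := by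
    conv_lhs => rw [Finset.sum_comm]
    rw [← Finset.sum_neg_distrib]
    refine Finset.sum_congr rfl fun a ha => ?_
    rw [← Finset.sum_neg_distrib]
    refine Finset.sum_congr rfl fun b hb => ?_
    rw [hW a (hsub a ha) b (hsub b hb)]
    ring
  have h0 : ∑ a ∈ Finset.Icc 1 i, ∑ b ∈ Finset.Icc 1 i, W a b * (p b - p a) = 0 := by linarith
  unfold resid flow
  simp_rw [sum_Icc_split _ hi]
  rw [Finset.sum_add_distrib, h0, zero_add]

/-- Each residual is the difference of the flows on its two sides, with zero flow beyond both ends.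
Hence the quality depends on the weights only through the flows. -/
theorem quality_eq_partialQ {m : ℕ} (hm : 1 ≤ m) (p : ℕ → ℝ) {W : ℕ → ℕ → ℝ} {w : ℕ → ℝ}
    (hW : ∀ i ∈ Finset.Icc 1 (m + 1), ∀ j ∈ Finset.Icc 1 (m + 1), W i j = W j i)
    (hw : ∀ i, 1 ≤ i → i ≤ m → flow (m + 1) p W i = gap p i * w i) :
    quality (m + 1) p W = partialQ (gap p) m w := by
  have hres : ∀ i, i ≤ m → resid (m + 1) p W (i + 1)
      = flow (m + 1) p W (i + 1) - flow (m + 1) p W i := by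
    intro i hi
    rw [← sum_resid p hW (show i + 1 ≤ m + 1 by omega), ← sum_resid p hW (show i ≤ m + 1 by omega),
      Finset.sum_Icc_succ_top (by omega)]
    ring
  have hlast : flow (m + 1) p W (m + 1) = 0 := by simp [flow]
  have hfirst : flow (m + 1) p W 0 = 0 := by simp [flow]
  have hmid : ∑ j ∈ Finset.Icc 2 m, resid (m + 1) p W j ^ 2
      = ∑ j ∈ Finset.Icc 2 m, (gap p j * w j - gap p (j - 1) * w (j - 1)) ^ 2 := by
    refine Finset.sum_congr rfl fun j hj => ?_
    rw [Finset.mem_Icc] at hj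
    obtain ⟨k, rfl⟩ : ∃ k, j = k + 1 := ⟨j - 1, by omega⟩
    rw [hres k (by omega), hw _ (by omega) hj.2, Nat.add_sub_cancel, hw k (by omega) (by omega)]
  unfold quality partialQ
  simp only [Real.norm_eq_abs, sq_abs]
  rw [Finset.sum_Icc_succ_top (by omega), ← Finset.add_sum_Ioc_eq_sum_Icc hm,
    show Finset.Ioc 1 m = Finset.Icc 2 m by ext; simp [Nat.succ_le_iff], hmid, hres m le_rfl,
    hlast, hw m hm le_rfl, show resid (m + 1) p W 1 = gap p 1 * w 1 by
      rw [hres 0 (by omega), hfirst, hw 1 le_rfl hm, sub_zero]]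
  ring

theorem gap_pos {n : ℕ} {p : ℕ → ℝ} (hp : StrictMonoOn p (Icc 1 n)) {i : ℕ} (h1 : 1 ≤ i)
    (h2 : i + 1 ≤ n) : 0 < gap p i :=
  sub_pos.2 (hp ⟨h1, by omega⟩ ⟨by omega, h2⟩ (by omega))

section Reduction

variable {n : ℕ} {p : ℕ → ℝ} {W : ℕ → ℕ → ℝ}

/-- Every pair counted in the cut spans the whole gap, so its length is at least the gap. -/
theorem cut_mul_gap_le_flow (hp : StrictMonoOn p (Icc 1 n)) (hW : Feasible n W) {i : ℕ}
    (h1 : 1 ≤ i) (h2 : i + 1 ≤ n) :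
    (∑ a ∈ Finset.Icc 1 i, ∑ b ∈ Finset.Icc (i + 1) n, W a b) * gap p i ≤ flow n p W i := by
  unfold flow
  rw [Finset.sum_mul]
  refine Finset.sum_le_sum fun a ha => ?_
  rw [Finset.sum_mul]
  refine Finset.sum_le_sum fun b hb => ?_
  rw [Finset.mem_Icc] at ha hb
  have ha' : p a ≤ p i := hp.monotoneOn ⟨ha.1, by omega⟩ ⟨h1, by omega⟩ ha.2
  have hb' : p (i + 1) ≤ p b := hp.monotoneOn ⟨by omega, h2⟩ ⟨by omega, hb.2⟩ hb.1
  refine mul_le_mul_of_nonneg_left ?_ (hW.nonneg a ?_ b ?_)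
  · unfold gap; linarith
  · rw [Finset.mem_Icc]; omega
  · rw [Finset.mem_Icc]; omega

theorem cut_le (hp : StrictMonoOn p (Icc 1 n)) (hW : Feasible n W) {i : ℕ}
    (h1 : 1 ≤ i) (h2 : i + 1 ≤ n) :
    ∑ a ∈ Finset.Icc 1 i, ∑ b ∈ Finset.Icc (i + 1) n, W a b ≤ flow n p W i / gap p i := by
  rw [le_div_iff₀ (gap_pos hp h1 h2)]
  exact cut_mul_gap_le_flow hp hW h1 h2

theorem Feasible.nonneg_of_cut (hW : Feasible n W) {i a b : ℕ} (h2 : i + 1 ≤ n)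
    (ha : a ∈ Finset.Icc 1 i) (hb : b ∈ Finset.Icc (i + 1) n) : 0 ≤ W a b := by
  rw [Finset.mem_Icc] at ha hb
  exact hW.nonneg a (by rw [Finset.mem_Icc]; omega) b (by rw [Finset.mem_Icc]; omega)

theorem right_sum_le (hp : StrictMonoOn p (Icc 1 n)) (hW : Feasible n W) {i : ℕ}
    (h1 : 1 ≤ i) (h2 : i + 1 ≤ n) :
    ∑ b ∈ Finset.Icc (i + 1) n, W i b ≤ flow n p W i / gap p i := by
  refine le_trans ?_ (cut_le hp hW h1 h2)
  exact Finset.single_le_sum (f := fun a => ∑ b ∈ Finset.Icc (i + 1) n, W a b)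
    (fun a ha => Finset.sum_nonneg fun b hb => hW.nonneg_of_cut h2 ha hb)
    (Finset.mem_Icc.2 ⟨h1, le_rfl⟩)

theorem left_sum_le (hp : StrictMonoOn p (Icc 1 n)) (hW : Feasible n W) {i : ℕ}
    (h1 : 1 ≤ i) (h2 : i + 1 ≤ n) :
    ∑ a ∈ Finset.Icc 1 i, W (i + 1) a ≤ flow n p W i / gap p i := by
  refine le_trans ?_ (cut_le hp hW h1 h2)
  refine Finset.sum_le_sum fun a ha => ?_
  have ha' := Finset.mem_Icc.1 ha
  rw [hW.symm (i + 1) (by rw [Finset.mem_Icc]; omega) a (by rw [Finset.mem_Icc]; omega)]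
  exact Finset.single_le_sum (f := fun b => W a b) (fun b hb => hW.nonneg_of_cut h2 ha hb)
    (Finset.mem_Icc.2 ⟨le_rfl, h2⟩)

theorem Feasible.one_le_left_add_right (hW : Feasible n W) {i : ℕ} (h2 : i + 1 ≤ n) :
    1 ≤ ∑ a ∈ Finset.Icc 1 i, W (i + 1) a + ∑ b ∈ Finset.Icc (i + 2) n, W (i + 1) b := by
  have h := hW.one_le_sum (i + 1) (by rw [Finset.mem_Icc]; omega)
  rw [sum_Icc_split _ h2, Finset.sum_Icc_succ_top (by omega),
    hW.diag (i + 1) (by rw [Finset.mem_Icc]; omega), add_zero] at h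
  exact h

end Reduction

/-- The chain weight flow / gap dominates the weight across its gap, hence the total weight from
either adjacent point across it. The degree condition at a point therefore passes to the sum of the
two neighbouring chain weights. -/
theorem exists_prefixFeasible_of_feasible {m : ℕ} (hm : 1 ≤ m) {p : ℕ → ℝ}
    (hp : StrictMonoOn p (Icc 1 (m + 1))) {W : ℕ → ℕ → ℝ} (hW : Feasible (m + 1) W) :
    ∃ w, PrefixFeasible m w ∧ 1 ≤ w m ∧ quality (m + 1) p W = partialQ (gap p) m w := by
  refine ⟨fun i => flow (m + 1) p W i / gap p i, ⟨fun j h1 h2 => ?_, ?_, fun j h1 h2 => ?_⟩, ?_,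
    quality_eq_partialQ hm p hW.symm fun i h1 h2 => ?_⟩
  · refine le_trans (Finset.sum_nonneg fun b hb => ?_) (right_sum_le hp hW h1 (by omega))
    exact hW.nonneg_of_cut (show j + 1 ≤ m + 1 by omega) (Finset.mem_Icc.2 ⟨h1, le_rfl⟩) hb
  · have h := hW.one_le_left_add_right (i := 0) (by omega)
    have h' := right_sum_le hp hW le_rfl (show 1 + 1 ≤ m + 1 by omega)
    simp only [zero_add, Finset.Icc_eq_empty_of_lt zero_lt_one, Finset.sum_empty] at h
    exact h.trans h'
  · have h := hW.one_le_left_add_right (i := j) (by omega)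
    have h3 := right_sum_le hp hW (show 1 ≤ j + 1 by omega) (by omega)
    have h4 := left_sum_le hp hW (show 1 ≤ j by omega) (by omega)
    exact h.trans (add_le_add h4 h3)
  · have h := hW.one_le_left_add_right (i := m) le_rfl
    have h4 := left_sum_le hp hW hm le_rfl
    rw [Finset.Icc_eq_empty_of_lt (show m + 1 < m + 2 by omega), Finset.sum_empty, add_zero] at h
    exact h.trans h4
  · have := gap_pos hp h1 (show i + 1 ≤ m + 1 by omega)
    field_simp

theorem chainWeights_symm (w : ℕ → ℝ) (i j : ℕ) : chainWeights w i j = chainWeights w j i := by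
  unfold chainWeights
  split_ifs <;> first | rfl | omega

theorem chainWeights_succ (w : ℕ → ℝ) (i : ℕ) : chainWeights w i (i + 1) = w i := by
  simp [chainWeights]

theorem feasible_chainWeights {m : ℕ} (hm : 1 ≤ m) {w : ℕ → ℝ} (hw : PrefixFeasible m w)
    (hwm : 1 ≤ w m) : Feasible (m + 1) (chainWeights w) := by
  have hnn : ∀ i ∈ Finset.Icc 1 (m + 1), ∀ j ∈ Finset.Icc 1 (m + 1), 0 ≤ chainWeights w i j := by
    intro i hi j hj
    rw [Finset.mem_Icc] at hi hj
    unfold chainWeights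
    split_ifs with h1 h2
    · exact hw.nonneg i hi.1 (by omega)
    · exact hw.nonneg j hj.1 (by omega)
    · exact le_rfl
  refine ⟨hnn, fun i _ j _ => chainWeights_symm w i j, fun i _ => ?_, fun i hi => ?_⟩
  · simp [chainWeights]
  have hge : ∀ j ∈ Finset.Icc 1 (m + 1),
      chainWeights w i j ≤ ∑ j ∈ Finset.Icc 1 (m + 1), chainWeights w i j :=
    fun j hj => Finset.single_le_sum (f := fun j => chainWeights w i j) (hnn i hi) hj
  have hi' := Finset.mem_Icc.1 hi
  by_cases h1 : i = 1
  · subst h1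
    have := hge 2 (by rw [Finset.mem_Icc]; omega)
    rw [chainWeights_succ w 1] at this
    exact hw.one_le_first.trans this
  -- The prefix constraints contain no condition on w 1 + w 2; point 2 is served by w 1 ≥ 1 alone.
  by_cases h2 : i = 2
  · subst h2
    have := hge 1 (by rw [Finset.mem_Icc]; omega)
    rw [chainWeights_symm, chainWeights_succ w 1] at this
    exact hw.one_le_first.trans this
  obtain ⟨k, rfl⟩ : ∃ k, i = k + 1 := ⟨i - 1, by omega⟩
  by_cases h3 : k = m
  · subst h3
    have := hge k (by rw [Finset.mem_Icc]; omega)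
    rw [chainWeights_symm, chainWeights_succ w k] at this
    exact hwm.trans this
  have hsub : ({k, k + 2} : Finset ℕ) ⊆ Finset.Icc 1 (m + 1) := by
    intro j hj
    rw [Finset.mem_insert, Finset.mem_singleton] at hj
    rw [Finset.mem_Icc]
    omega
  have := Finset.sum_le_sum_of_subset_of_nonneg hsub fun j hj _ => hnn (k + 1) hi j hj
  rw [Finset.sum_pair (by omega), chainWeights_symm, chainWeights_succ w k,
    chainWeights_succ w (k + 1)] at this
  exact (hw.one_le_add k (by omega) (by omega)).trans this

theorem quality_chainWeights {m : ℕ} (hm : 1 ≤ m) (p w : ℕ → ℝ) :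
    quality (m + 1) p (chainWeights w) = partialQ (gap p) m w := by
  refine quality_eq_partialQ hm p (fun i _ j _ => chainWeights_symm w i j) fun i h1 h2 => ?_
  unfold flow
  rw [Finset.sum_eq_single i, Finset.sum_eq_single (i + 1), chainWeights_succ]
  · unfold gap; ring
  · intro b hb hne
    rw [Finset.mem_Icc] at hb
    unfold chainWeights
    rw [if_neg hne, if_neg (by omega), zero_mul]
  · intro h
    exact absurd (Finset.mem_Icc.2 ⟨le_rfl, by omega⟩) h
  · intro a ha hne
    refine Finset.sum_eq_zero fun b hb => ?_
    rw [Finset.mem_Icc] at ha hb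
    unfold chainWeights
    rw [if_neg (by omega), if_neg (by omega), zero_mul]
  · intro h
    exact absurd (Finset.mem_Icc.2 ⟨h1, le_rfl⟩) h

theorem isOptimal_chainWeights {m : ℕ} (hm : 1 ≤ m) {p : ℕ → ℝ}
    (hp : StrictMonoOn p (Icc 1 (m + 1))) {w : ℕ → ℝ} (hw : PrefixFeasible m w) (hwm : 1 ≤ w m)
    (hmin : ∀ w', PrefixFeasible m w' → 1 ≤ w' m →
      partialQ (gap p) m w ≤ partialQ (gap p) m w') :
    IsOptimal (m + 1) p (chainWeights w) := by
  refine ⟨feasible_chainWeights hm hw hwm, fun W' hW' => ?_⟩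
  obtain ⟨w', h1, h2, h3⟩ := exists_prefixFeasible_of_feasible hm hp hW'
  rw [h3, quality_chainWeights hm]
  exact hmin w' h1 h2

/-! ### Optimality of the back-substitution -/

theorem BackSubstitution.nonneg {n : ℕ} {d w : ℕ → ℝ} (h : BackSubstitution n d w) {i : ℕ}
    (h1 : 1 ≤ i) (h2 : i + 1 ≤ n) : 0 ≤ w i := by
  by_cases hn : n = 2
  · obtain rfl : i = 1 := by omega
    rw [h.two hn]; exact zero_le_one
  by_cases hi1 : i = 1
  · rw [hi1, h.first (by omega)]
    exact zero_le_one.trans (le_max_right _ _)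
  by_cases hin : i + 1 = n
  · obtain ⟨u, hu, hw⟩ := h.last (by omega)
    rw [show i = n - 1 by omega, hw]
    exact hu.1.trans (le_max_left _ _)
  · obtain ⟨u, hu, hw⟩ := h.middle i (by omega) (by omega)
    rw [hw]
    exact hu.1.trans (le_max_left _ _)

/-- Each formula picks the minimizer of the recursion for the given next weight, so every prefix is
optimal for its own last weight. -/
theorem BackSubstitution.prefix_optimal {n : ℕ} {d w : ℕ → ℝ} (hn : 3 ≤ n)
    (h : BackSubstitution n d w) (hd : ∀ j, 1 ≤ j → j + 1 ≤ n → 0 < d j) {i : ℕ} (hi : 2 ≤ i)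
    (hin : i + 1 ≤ n) : PrefixFeasible i w ∧ partialQ d i w = minQ d i (w i) := by
  induction i, hi using Nat.le_induction with
  | base =>
    have h2 := h.nonneg (show 1 ≤ 2 by omega) hin
    refine ⟨(prefixFeasible_two w).2 ⟨by rw [h.first hn]; exact le_max_right _ _, h2⟩, ?_⟩
    have := ((regular_two (hd 1 le_rfl (by omega)) (hd 2 (by omega) hin)).2 (w 2) h2 _
      (h.first hn)).1
    rw [partialQ_two, this]
  | succ i hi ih =>
    obtain ⟨ih1, ih2⟩ := ih (by omega)
    have hw := h.nonneg (show 1 ≤ i + 1 by omega) hin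
    obtain ⟨u, hu, hwi⟩ := h.middle i hi (by omega)
    have hreg := regular hi fun j h1 h2 => hd j h1 (by omega)
    have := ((hreg.succ hi (hd i (by omega) (by omega)) (hd (i + 1) (by omega) hin)).2 _ hw u hu _
      hwi).1
    refine ⟨(prefixFeasible_succ hi w).2 ⟨ih1, hw, ?_⟩, ?_⟩
    · have := le_max_right u (1 - w (i + 1))
      rw [← hwi] at this
      linarith
    · rw [partialQ_succ d (by omega), this, ih2]

theorem BackSubstitution.isOptimal {n : ℕ} (hn : 2 ≤ n) {p w : ℕ → ℝ}
    (hp : StrictMonoOn p (Icc 1 n)) (h : BackSubstitution n (gap p) w) :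
    IsOptimal n p (chainWeights w) := by
  have hd : ∀ j, 1 ≤ j → j + 1 ≤ n → 0 < gap p j := fun j h1 h2 => gap_pos hp h1 h2
  by_cases hn2 : n = 2
  · subst hn2
    have hw := h.two rfl
    refine isOptimal_chainWeights le_rfl hp ⟨fun j h1 h2 => h.nonneg h1 (by omega), hw.ge,
      fun j h1 h2 => by omega⟩ hw.ge fun w' _ h' => ?_
    rw [partialQ_one, partialQ_one, hw]
    have : 1 ≤ w' 1 ^ 2 := one_le_pow₀ h'
    nlinarith [sq_nonneg (gap p 1)]
  obtain ⟨m, rfl⟩ : ∃ m, n = m + 1 := ⟨n - 1, by omega⟩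
  have hm : 2 ≤ m := by omega
  obtain ⟨hpf, hq⟩ := h.prefix_optimal (by omega) hd hm le_rfl
  have hreg := regular hm fun j h1 h2 => hd j h1 (by omega)
  obtain ⟨u, hu, hw⟩ := h.last (by omega)
  rw [Nat.add_sub_cancel] at hu hw
  have hw1 : 1 ≤ w m := hw ▸ le_max_right _ _
  have hw0 : 0 ≤ w m := by linarith
  refine isOptimal_chainWeights (by omega) hp hpf hw1 fun w' h1 h2 => ?_
  have hw'0 : 0 ≤ w' m := by linarith
  have hle := (hreg.isLeast (w' m) hw'0).2 ⟨w', h1, rfl, rfl⟩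
  have hlow := hreg.lower (w m) (w' m) hw0 hw'0
  have hsq : 0 ≤ gap p m ^ 2 * (w' m - w m) ^ 2 := by positivity
  -- First-order condition for minimizing Q_m over [1, ∞): either the derivative vanishes, or the
  -- minimizer is the endpoint 1 and the derivative there is nonnegative.
  have hderiv : 0 ≤ derivQ (gap p) m (w m) * (w' m - w m) := by
    rcases le_total u 1 with hu1 | hu1
    · rw [max_eq_right hu1] at hw
      have := (hreg.strictMonoOn (hd m (by omega) le_rfl)).monotoneOn hu.1 hw0 (hw ▸ hu1)
      rw [hu.2] at this
      exact mul_nonneg this (by linarith)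
    · rw [max_eq_left hu1] at hw
      rw [hw, hu.2, zero_mul]
  linarith

/-! ### Transfer of graphs and intersection with lines -/

theorem transfers_iff (d : ℕ → ℝ) (i : ℕ) (A : Matrix (Fin 3) (Fin 3) ℝ) (x : ℝ) :
    Transfers d i A x ↔ ∃ x₀, 0 ≤ x₀ ∧ x = A 0 0 * x₀ + A 0 1 * derivQ d i x₀ + A 0 2 ∧
      derivQ d (i + 1) x = A 1 0 * x₀ + A 1 1 * derivQ d i x₀ + A 1 2 ∧
      1 = A 2 0 * x₀ + A 2 1 * derivQ d i x₀ + A 2 2 := by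
  unfold Transfers
  refine exists_congr fun x₀ => and_congr_right fun _ => ?_
  rw [funext_iff]
  simp [Fin.forall_fin_succ, Matrix.mulVec, dotProduct, Fin.sum_univ_succ, add_assoc]

theorem transfers_matM_iff (d : ℕ → ℝ) (i : ℕ) (x : ℝ) :
    Transfers d i (matM d i) x ↔ ∃ x₀, 0 ≤ x₀ ∧ x = derivQ d i x₀ / xi d i ∧
      derivQ d (i + 1) x = -xi d i * x₀ + 4 * d (i + 1) ^ 2 / xi d i * derivQ d i x₀ := by
  rw [transfers_iff]
  simp [matM, div_eq_inv_mul]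

theorem transfers_matL_iff (d : ℕ → ℝ) (i : ℕ) (x : ℝ) :
    Transfers d i (matL d i) x ↔ ∃ x₀, 0 ≤ x₀ ∧ x = 1 - x₀ ∧
      derivQ d (i + 1) x = (-2 * xi d i - 4 * d (i + 1) ^ 2) * x₀ - derivQ d i x₀
        + (xi d i + 4 * d (i + 1) ^ 2) := by
  rw [transfers_iff]
  simp [matL, sub_eq_add_neg, add_comm]

namespace Regular

variable {d : ℕ → ℝ} {i : ℕ}

theorem exists_line_root (h : Regular d i) (hd : 0 < d i) {α γ : ℝ} (hα : 0 ≤ α) (hγ : γ ≤ 0) :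
    ∃ x, 0 ≤ x ∧ α * x + derivQ d i x + γ = 0 := by
  -- For the intermediate value theorem: the function is negative at 0, and at R_i⁻¹(-γ) it equals α
  -- X ≥ 0.
  obtain ⟨X, hX, hX'⟩ := h.exists_isInvR hd (show 0 ≤ -γ by linarith)
  have hc : ContinuousOn (fun x => α * x + derivQ d i x + γ) (Icc 0 X) := by
    have := h.cont.mono (fun a (ha : a ∈ Icc 0 X) => ha.1)
    fun_prop
  have h0 := h.zero_neg
  obtain ⟨x, hx, hx'⟩ := intermediate_value_Icc hX hc
    (show (0 : ℝ) ∈ Icc _ _ from ⟨by linarith, by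
      have := mul_nonneg hα hX
      linarith⟩)
  exact ⟨x, hx.1, hx'⟩

/-- A line that is not too steep increases along the graph of `R i`. -/
theorem line_le_line_iff (h : Regular d i) {α β : ℝ} (hβ : 0 ≤ β) (hαβ : 0 < α + 2 * d i ^ 2 * β)
    {x y : ℝ} (hx : 0 ≤ x) (hy : 0 ≤ y) :
    α * x + β * derivQ d i x ≤ α * y + β * derivQ d i y ↔ x ≤ y := by
  have key : ∀ a b : ℝ, 0 ≤ a → a ≤ b →
      (α + 2 * d i ^ 2 * β) * (b - a)
        ≤ (α * b + β * derivQ d i b) - (α * a + β * derivQ d i a) := by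
    intro a b ha hab
    have := mul_le_mul_of_nonneg_left (h.slope ha hab) hβ
    linarith
  constructor
  · intro hle
    by_contra! hlt
    have := key y x hy hlt.le
    have := mul_pos hαβ (sub_pos.2 hlt)
    linarith
  · intro hle
    have := key x y hx hle
    have := mul_nonneg hαβ.le (sub_nonneg.2 hle)
    linarith

/-- Here g is the optimal weight before x. Either its multiplier vanishes and the derivative formula
reads as M, or the constraint is tight and it reads as L. -/
theorem transfers_dichotomy (h : Regular d i) (hi : 2 ≤ i) (hd : 0 < d i) (hd' : 0 < d (i + 1))
    {x : ℝ} (hx : 0 ≤ x) :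
    ∃ g, 0 ≤ g ∧ 1 - x ≤ g ∧ xi d i * x ≤ derivQ d i g ∧
      (derivQ d i g = xi d i * x → Transfers d i (matM d i) x) ∧
      (g = 1 - x → Transfers d i (matL d i) x) ∧ (derivQ d i g = xi d i * x ∨ g = 1 - x) := by
  have hxi : 0 < xi d i := by unfold xi; positivity
  obtain ⟨u, hu⟩ := h.exists_isInvR hd (show 0 ≤ xi d i * x by positivity)
  have hstep := ((h.succ hi hd hd').2 x hx u hu _ rfl).2
  set g := max u (1 - x) with hg
  have hug : u ≤ g := le_max_left _ _
  refine ⟨g, hu.1.trans hug, le_max_right _ _, ?_, fun he => ?_, fun he => ?_, ?_⟩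
  · rw [← hu.2]
    exact (h.strictMonoOn hd).monotoneOn hu.1 (hu.1.trans hug) hug
  · rw [transfers_matM_iff]
    refine ⟨g, hu.1.trans hug, ?_, ?_⟩
    · rw [he]; field_simp
    · rw [hstep, he]; field_simp; ring
  · rw [transfers_matL_iff]
    refine ⟨g, hu.1.trans hug, by linarith, ?_⟩
    rw [hstep, he]; ring
  · rcases max_choice u (1 - x) with hm | hm
    · left; rw [hg, hm]; exact hu.2
    · right; exact hm

/-- If the constraint is tight, then g ≤ 1 ≤ u gives R_i(g) ≤ 0, so the multiplier cannot be
positive. -/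
theorem transfers_matM_of_one_le (h : Regular d i) (hi : 2 ≤ i) (hd : 0 < d i) (hd' : 0 < d (i + 1))
    {u : ℝ} (hu1 : 1 ≤ u) (hu : IsInvR d i 0 u) {x : ℝ}
    (hx : 0 ≤ x) : Transfers d i (matM d i) x := by
  have hxi : 0 < xi d i := by unfold xi; positivity
  obtain ⟨g, hg, h1, h2, hM, -, h3⟩ := h.transfers_dichotomy hi hd hd' hx
  rcases h3 with h3 | h3
  · exact hM h3
  · have h4 := (h.strictMonoOn hd).monotoneOn hg hu.1 (by linarith)
    rw [hu.2] at h4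
    exact hM (le_antisymm (h4.trans (by positivity)) h2)

/-- At x = 1 - x₀ both cases hold at once with g = x₀. Monotonicity of R_i shows that the tight case
covers everything to the left and the case of zero multiplier everything to the right. -/
theorem breakpoint (h : Regular d i) (hi : 2 ≤ i) (hd : 0 < d i) (hd' : 0 < d (i + 1))
    {u x₀ : ℝ} (hu1 : u < 1) (hu : IsInvR d i 0 u) (hx₀ : 0 ≤ x₀)
    (hroot : xi d i * x₀ + derivQ d i x₀ - xi d i = 0) :
    0 < 1 - x₀ ∧ 1 - x₀ < 1 ∧
      derivQ d (i + 1) (1 - x₀) = 4 * d (i + 1) ^ 2 * (1 - x₀) - xi d i * x₀ ∧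
      (∀ x, 0 ≤ x → x ≤ 1 - x₀ → Transfers d i (matL d i) x) ∧
      ∀ x, 1 - x₀ ≤ x → Transfers d i (matM d i) x := by
  have hxi : 0 < xi d i := by unfold xi; positivity
  have hmono := (h.strictMonoOn hd).monotoneOn
  have hlt : x₀ < 1 := by
    by_contra! hge
    have h1 := h.strictMonoOn hd hu.1 (show x₀ ∈ Ici 0 from hx₀) (hu1.trans_le hge)
    rw [hu.2] at h1
    nlinarith
  have hpos : 0 < x₀ := by
    by_contra! hle
    have h1 := hmono (show x₀ ∈ Ici 0 from hx₀) hu.1 (hle.trans hu.1)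
    rw [hu.2] at h1
    nlinarith
  refine ⟨by linarith, by linarith, ?_, fun x hx hxle => ?_, fun x hxge => ?_⟩
  · have := ((h.succ hi hd hd').2 (1 - x₀) (by linarith) x₀ ⟨hx₀, by linarith⟩ x₀
      (by simp)).2
    rw [this]; linarith
  · obtain ⟨g, hg, h1, h2, -, hL, h3⟩ := h.transfers_dichotomy hi hd hd' hx
    rcases h3 with h3 | h3
    · refine hL (le_antisymm ?_ h1)
      have h4 : derivQ d i g ≤ derivQ d i x₀ := by
        rw [h3]; nlinarith
      have h5 : g ≤ x₀ := (h.strictMonoOn hd).le_iff_le hg hx₀ |>.1 h4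
      linarith
    · exact hL h3
  · have hx : 0 ≤ x := by linarith
    obtain ⟨g, hg, h1, h2, hM, -, h3⟩ := h.transfers_dichotomy hi hd hd' hx
    rcases h3 with h3 | h3
    · exact hM h3
    · refine hM (le_antisymm ?_ h2)
      have h4 := hmono hg (show x₀ ∈ Ici 0 from hx₀) (by linarith)
      nlinarith

end Regular

end DKS

namespace DKS

/-! ### Straight-line code with expressions

Registers from `64` on hold intermediate results; two states that differ only there are regarded
as equal. -/

section StateLemmas

variable (s : State) (a b A B k j r x v : ℕ) (y : ℝ)

@[simp] theorem State.setIdx_idx : (s.setIdx a v).idx b = if b = a then v else s.idx b := by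
  simp [State.setIdx, Function.update_apply]
@[simp] theorem State.setIdx_reg : (s.setIdx a v).reg = s.reg := rfl
@[simp] theorem State.setIdx_mem : (s.setIdx a v).mem = s.mem := rfl
@[simp] theorem State.setReg_idx : (s.setReg r y).idx = s.idx := rfl
@[simp] theorem State.setReg_reg : (s.setReg r y).reg x = if x = r then y else s.reg x := by
  simp [State.setReg, Function.update_apply]
@[simp] theorem State.setReg_mem : (s.setReg r y).mem = s.mem := rfl
@[simp] theorem State.setMem_idx : (s.setMem A k y).idx = s.idx := rfl
@[simp] theorem State.setMem_reg : (s.setMem A k y).reg = s.reg := rfl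
@[simp] theorem State.setMem_mem :
    (s.setMem A k y).mem B j = if B = A ∧ j = k then y else s.mem B j := by
  unfold State.setMem
  by_cases hB : B = A
  · subst hB
    by_cases hj : j = k <;> simp [hj]
  · simp [hB]

end StateLemmas

/-- The states agree except on the registers for intermediate results. -/
structure Agree (s s' : State) : Prop where
  idx : s.idx = s'.idx
  mem : s.mem = s'.mem
  reg : ∀ r, r < 64 → s.reg r = s'.reg r

theorem Agree.refl (s : State) : Agree s s := ⟨rfl, rfl, fun _ _ => rfl⟩

/-- A bound for the number of steps per unit of the parameter in `Runs`. -/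
def Prog.cost : Prog → ℕ
  | .skip => 1
  | .instr _ => 1
  | .seq P Q => P.cost + Q.cost
  | .ite _ P Q => 1 + (P.cost + Q.cost)
  | .loop _ P => P.cost + 2

/-- Up to intermediate results, `P` leads from `s` to `s'` in at most `P.cost * N` steps. -/
def Runs (P : Prog) (N : ℕ) (s s' : State) : Prop :=
  ∀ s₀, Agree s₀ s → ∃ t s₁, Exec P s₀ t s₁ ∧ t ≤ P.cost * N ∧ Agree s₁ s'

/-- The test does not use registers for intermediate results. -/
def Test.Visible : Test → Prop
  | .idxLt _ _ => True
  | .idxLe _ _ => True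
  | .realLt x y => x < 64 ∧ y < 64
  | .realLe x y => x < 64 ∧ y < 64

theorem Test.holds_iff {b : Test} (hb : b.Visible) {s s' : State} (h : Agree s s') :
    b.Holds s ↔ b.Holds s' := by
  cases b with
  | idxLt => simp only [Test.Holds, h.idx]
  | idxLe => simp only [Test.Holds, h.idx]
  | realLt => simp only [Test.Holds, h.reg _ hb.1, h.reg _ hb.2]
  | realLe => simp only [Test.Holds, h.reg _ hb.1, h.reg _ hb.2]

/-! ### Composition rules with step bounds -/

namespace Runs

variable {P Q : Prog} {b : Test} {N M : ℕ} {s s' s'' : State}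

theorem mono (h : Runs P N s s') (hN : N ≤ M) : Runs P M s s' := by
  intro s₀ h₀
  obtain ⟨t, s₁, h1, h2, h3⟩ := h s₀ h₀
  exact ⟨t, s₁, h1, h2.trans (Nat.mul_le_mul_left _ hN), h3⟩

theorem skip (hN : 1 ≤ N) : Runs Prog.skip N s s := fun s₀ h₀ =>
  ⟨1, s₀, Exec.skip s₀, by simpa [Prog.cost] using hN, h₀⟩

theorem seq (h : Runs P N s s') (h' : Runs Q N s' s'') : Runs (Prog.seq P Q) N s s'' := by
  intro s₀ h₀
  obtain ⟨t, s₁, h1, h2, h3⟩ := h s₀ h₀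
  obtain ⟨t', s₂, h4, h5, h6⟩ := h' s₁ h3
  exact ⟨t + t', s₂, Exec.seq h1 h4, by simp only [Prog.cost, add_mul]; omega, h6⟩

theorem iteTrue (hb : b.Visible) (hs : b.Holds s) (hN : 1 ≤ N) (h : Runs P N s s') :
    Runs (Prog.ite b P Q) N s s' := by
  intro s₀ h₀
  obtain ⟨t, s₁, h1, h2, h3⟩ := h s₀ h₀
  refine ⟨1 + t, s₁, Exec.iteTrue ((Test.holds_iff hb h₀).2 hs) h1, ?_, h3⟩
  simp only [Prog.cost, add_mul]; omega

theorem iteFalse (hb : b.Visible) (hs : ¬ b.Holds s) (hN : 1 ≤ N) (h : Runs Q N s s') :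
    Runs (Prog.ite b P Q) N s s' := by
  intro s₀ h₀
  obtain ⟨t, s₁, h1, h2, h3⟩ := h s₀ h₀
  refine ⟨1 + t, s₁, Exec.iteFalse (mt (Test.holds_iff hb h₀).1 hs) h1, ?_, h3⟩
  simp only [Prog.cost, add_mul]; omega

/-- A loop with an invariant `I k`, where `k` is the number of iterations that remain. -/
theorem loop (hb : b.Visible) (I : ℕ → State → Prop)
    (hstep : ∀ k s, I (k + 1) s → b.Holds s ∧ ∃ s', Runs P N s s' ∧ I k s')
    (hend : ∀ s, I 0 s → ¬ b.Holds s) (hN : 1 ≤ N) :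
    ∀ k s, I k s → ∃ s', Runs (Prog.loop b P) (N * (k + 1)) s s' ∧ I 0 s' := by
  -- The exact count charges one test per iteration and one final test; it is rounded up at the end
  -- to the product form that nested loops need.
  have key : ∀ k s, I k s → ∃ s', I 0 s' ∧ ∀ s₀, Agree s₀ s → ∃ t s₁,
      Exec (Prog.loop b P) s₀ t s₁ ∧ t ≤ k * (P.cost * N + 1) + 1 ∧ Agree s₁ s' := by
    intro k
    induction k with
    | zero =>
      intro s hs
      exact ⟨s, hs, fun s₀ h₀ => ⟨1, s₀,
        Exec.loopFalse (mt (Test.holds_iff hb h₀).1 (hend s hs)), by omega, h₀⟩⟩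
    | succ k ih =>
      intro s hs
      obtain ⟨hbs, s', hrun, hI⟩ := hstep k s hs
      obtain ⟨s'', hI0, hrest⟩ := ih s' hI
      refine ⟨s'', hI0, fun s₀ h₀ => ?_⟩
      obtain ⟨t, s₁, h1, h2, h3⟩ := hrun s₀ h₀
      obtain ⟨t', s₂, h4, h5, h6⟩ := hrest s₁ h3
      refine ⟨1 + t + t', s₂, Exec.loopTrue ((Test.holds_iff hb h₀).2 hbs) h1 h4, ?_, h6⟩
      rw [add_mul]; omega
  intro k s hs
  obtain ⟨s', hI, h⟩ := key k s hs
  refine ⟨s', fun s₀ h₀ => ?_, hI⟩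
  obtain ⟨t, s₁, h1, h2, h3⟩ := h s₀ h₀
  refine ⟨t, s₁, h1, h2.trans ?_, h3⟩
  simp only [Prog.cost]
  nlinarith [Nat.zero_le k, Nat.zero_le (P.cost * N)]

end Runs

/-! ### Compilation of real expressions -/

/-- Real expressions. -/
inductive RExpr where
  | const (c : ℤ)
  | reg (r : ℕ)
  | arr (A a : ℕ)
  | add (e f : RExpr)
  | sub (e f : RExpr)
  | mul (e f : RExpr)
  | div (e f : RExpr)

namespace RExpr

instance : Add RExpr := ⟨add⟩
instance : Sub RExpr := ⟨sub⟩
instance : Mul RExpr := ⟨mul⟩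
instance : Div RExpr := ⟨div⟩
instance (n : ℕ) : OfNat RExpr n := ⟨const n⟩

/-- The value of an expression. -/
noncomputable def eval (s : State) : RExpr → ℝ
  | const c => c
  | reg r => s.reg r
  | arr A a => s.mem A (s.idx a)
  | add e f => e.eval s + f.eval s
  | sub e f => e.eval s - f.eval s
  | mul e f => e.eval s * f.eval s
  | div e f => e.eval s / f.eval s

/-- The evaluation divides by nonzero numbers only and reads no intermediate results. -/
def Safe (s : State) : RExpr → Prop
  | const _ => True
  | reg r => r < 64
  | arr _ _ => True
  | add e f => e.Safe s ∧ f.Safe s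
  | sub e f => e.Safe s ∧ f.Safe s
  | mul e f => e.Safe s ∧ f.Safe s
  | div e f => e.Safe s ∧ f.Safe s ∧ f.eval s ≠ 0

variable (s : State) (e f : RExpr)

@[simp] theorem eval_reg (r : ℕ) : (reg r).eval s = s.reg r := rfl
@[simp] theorem eval_arr (A a : ℕ) : (arr A a).eval s = s.mem A (s.idx a) := rfl
@[simp] theorem eval_add : (e + f).eval s = e.eval s + f.eval s := rfl
@[simp] theorem eval_sub : (e - f).eval s = e.eval s - f.eval s := rfl
@[simp] theorem eval_mul : (e * f).eval s = e.eval s * f.eval s := rfl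
@[simp] theorem eval_div : (e / f).eval s = e.eval s / f.eval s := rfl
@[simp] theorem eval_zero : (0 : RExpr).eval s = 0 := by
  change (((0 : ℕ) : ℤ) : ℝ) = 0; simp
@[simp] theorem eval_one : (1 : RExpr).eval s = 1 := by
  change (((1 : ℕ) : ℤ) : ℝ) = 1; simp
@[simp] theorem eval_ofNat (n : ℕ) [n.AtLeastTwo] :
    (no_index (OfNat.ofNat n) : RExpr).eval s = OfNat.ofNat n := by
  change (((OfNat.ofNat n : ℕ) : ℤ) : ℝ) = _; simp

@[simp] theorem safe_ofNat (n : ℕ) : (no_index (OfNat.ofNat n) : RExpr).Safe s := trivial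
@[simp] theorem safe_reg (r : ℕ) : (reg r).Safe s ↔ r < 64 := Iff.rfl
@[simp] theorem safe_arr (A a : ℕ) : (arr A a).Safe s := trivial
@[simp] theorem safe_add : (e + f).Safe s ↔ e.Safe s ∧ f.Safe s := Iff.rfl
@[simp] theorem safe_sub : (e - f).Safe s ↔ e.Safe s ∧ f.Safe s := Iff.rfl
@[simp] theorem safe_mul : (e * f).Safe s ↔ e.Safe s ∧ f.Safe s := Iff.rfl
@[simp] theorem safe_div : (e / f).Safe s ↔ e.Safe s ∧ f.Safe s ∧ f.eval s ≠ 0 := Iff.rfl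

/-- Code that leaves the value of an expression in the register `k`. -/
def compile : RExpr → ℕ → Prog
  | const c, k => .instr (.realConst k c)
  | reg r, k => .instr (.realCopy k r)
  | arr A a, k => .instr (.load k A a)
  | add e f, k => .seq (e.compile k) (.seq (f.compile (k + 1)) (.instr (.realAdd k k (k + 1))))
  | sub e f, k => .seq (e.compile k) (.seq (f.compile (k + 1)) (.instr (.realSub k k (k + 1))))
  | mul e f, k => .seq (e.compile k) (.seq (f.compile (k + 1)) (.instr (.realMul k k (k + 1))))
  | div e f, k => .seq (e.compile k) (.seq (f.compile (k + 1)) (.instr (.realDiv k k (k + 1))))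

variable {s e f}

theorem eval_congr {s' : State} (h : Agree s s') (hs : e.Safe s') : e.eval s = e.eval s' := by
  induction e with
  | const => rfl
  | reg r => exact h.reg r hs
  | arr => simp [h.idx, h.mem]
  | add e f he hf => simp only [eval, he hs.1, hf hs.2]
  | sub e f he hf => simp only [eval, he hs.1, hf hs.2]
  | mul e f he hf => simp only [eval, he hs.1, hf hs.2]
  | div e f he hf => simp only [eval, he hs.1, hf hs.2.1]

theorem Safe.congr {s' : State} (h : Agree s s') (hs : e.Safe s') : e.Safe s := by
  induction e with
  | const => trivial
  | reg r => exact hs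
  | arr => trivial
  | add e f he hf => exact ⟨he hs.1, hf hs.2⟩
  | sub e f he hf => exact ⟨he hs.1, hf hs.2⟩
  | mul e f he hf => exact ⟨he hs.1, hf hs.2⟩
  | div e f he hf => exact ⟨he hs.1, hf hs.2.1, by rw [eval_congr h hs.2.1]; exact hs.2.2⟩

/-- The effect of the code of an expression. -/
structure Computes (P : Prog) (s : State) (k : ℕ) (v : ℝ) (t : ℕ) (s' : State) : Prop where
  exec : Exec P s t s'
  time : t ≤ P.cost
  idx : s'.idx = s.idx
  mem : s'.mem = s.mem
  value : s'.reg k = v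
  reg : ∀ r, r < k → s'.reg r = s.reg r

theorem Computes.agree {P : Prog} {k : ℕ} {v : ℝ} {t : ℕ} {s' : State}
    (h : Computes P s k v t s') (hk : 64 ≤ k) : Agree s' s :=
  ⟨h.idx, h.mem, fun r hr => h.reg r (by omega)⟩

theorem computes_instr {c : Instr} {k : ℕ} {v : ℝ} (h : c.step s = some (s.setReg k v)) :
    ∃ t s', Computes (.instr c) s k v t s' :=
  ⟨1, _, Exec.instr h, le_rfl, rfl, rfl, by simp, fun r hr => by simp [hr.ne]⟩

/-- Stack discipline: the second operand is evaluated into register k + 1 by code that leaves the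
registers up to k alone, so the first operand survives. -/
theorem computes_binary {c : Instr} {P Q : Prog} {k : ℕ} {v w z : ℝ} (hk : 64 ≤ k)
    (hP : ∃ t s', Computes P s k v t s')
    (hQ : ∀ s', Agree s' s → ∃ t s'', Computes Q s' (k + 1) w t s'')
    (hc : ∀ s' : State, s'.reg k = v → s'.reg (k + 1) = w → c.step s' = some (s'.setReg k z)) :
    ∃ t s', Computes (.seq P (.seq Q (.instr c))) s k z t s' := by
  obtain ⟨t1, s1, h1⟩ := hP
  obtain ⟨t2, s2, h2⟩ := hQ s1 (h1.agree hk)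
  have h3 := hc s2 (by rw [h2.reg k (by omega), h1.value]) h2.value
  refine ⟨t1 + (t2 + 1), _, Exec.seq h1.exec (Exec.seq h2.exec (Exec.instr h3)), ?_, ?_, ?_, ?_, ?_⟩
  · have := h1.time
    have := h2.time
    simp only [Prog.cost]
    omega
  · simp [h2.idx, h1.idx]
  · simp [h2.mem, h1.mem]
  · simp
  · intro r hr
    simp [hr.ne, h2.reg r (by omega), h1.reg r hr]

theorem compile_computes (e : RExpr) : ∀ (s : State) (k : ℕ), 64 ≤ k → e.Safe s →
    ∃ t s', Computes (e.compile k) s k (e.eval s) t s' := by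
  induction e with
  | const c => exact fun s k _ _ => computes_instr rfl
  | reg r => exact fun s k _ _ => computes_instr rfl
  | arr A a => exact fun s k _ _ => computes_instr rfl
  | add e f he hf =>
    intro s k hk hs
    refine computes_binary (w := f.eval s) hk (he s k hk hs.1) (fun s' h' => ?_) fun s' h1 h2 => ?_
    · rw [← eval_congr h' hs.2]
      exact hf s' (k + 1) (by omega) (hs.2.congr h')
    · simp only [Instr.step, h1, h2]; rfl
  | sub e f he hf =>
    intro s k hk hs
    refine computes_binary (w := f.eval s) hk (he s k hk hs.1) (fun s' h' => ?_) fun s' h1 h2 => ?_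
    · rw [← eval_congr h' hs.2]
      exact hf s' (k + 1) (by omega) (hs.2.congr h')
    · simp only [Instr.step, h1, h2]; rfl
  | mul e f he hf =>
    intro s k hk hs
    refine computes_binary (w := f.eval s) hk (he s k hk hs.1) (fun s' h' => ?_) fun s' h1 h2 => ?_
    · rw [← eval_congr h' hs.2]
      exact hf s' (k + 1) (by omega) (hs.2.congr h')
    · simp only [Instr.step, h1, h2]; rfl
  | div e f he hf =>
    intro s k hk hs
    refine computes_binary (w := f.eval s) hk (he s k hk hs.1) (fun s' h' => ?_) fun s' h1 h2 => ?_
    · rw [← eval_congr h' hs.2.1]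
      exact hf s' (k + 1) (by omega) (hs.2.1.congr h')
    · simp only [Instr.step, h1, h2, if_neg hs.2.2]; rfl

end RExpr

/-! ### Straight-line blocks of assignments -/

/-- Assignments. -/
inductive Assign where
  | real (r : ℕ) (e : RExpr)
  | cell (A a : ℕ) (e : RExpr)
  | idxConst (a c : ℕ)
  | idxCopy (a b : ℕ)
  | idxAdd (a b c : ℕ)
  | idxSub (a b c : ℕ)

namespace Assign

/-- The code of an assignment. -/
def prog : Assign → Prog
  | real r e => .seq (e.compile 64) (.instr (.realCopy r 64))
  | cell A a e => .seq (e.compile 64) (.instr (.store A a 64))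
  | idxConst a c => .instr (.idxConst a c)
  | idxCopy a b => .instr (.idxCopy a b)
  | idxAdd a b c => .instr (.idxAdd a b c)
  | idxSub a b c => .instr (.idxSub a b c)

/-- The state after an assignment. -/
noncomputable def apply (s : State) : Assign → State
  | real r e => s.setReg r (e.eval s)
  | cell A a e => s.setMem A (s.idx a) (e.eval s)
  | idxConst a c => s.setIdx a c
  | idxCopy a b => s.setIdx a (s.idx b)
  | idxAdd a b c => s.setIdx a (s.idx b + s.idx c)
  | idxSub a b c => s.setIdx a (s.idx b - s.idx c)

/-- The assignment has an effect that is given by `apply`. -/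
def Safe (s : State) : Assign → Prop
  | real r e => r < 64 ∧ e.Safe s
  | cell _ _ e => e.Safe s
  | idxConst _ _ => True
  | idxCopy _ _ => True
  | idxAdd _ _ _ => True
  | idxSub _ _ _ => True

theorem runs {c : Assign} {s : State} {N : ℕ} (hN : 1 ≤ N) (h : c.Safe s) :
    Runs c.prog N s (c.apply s) := by
  refine Runs.mono ?_ hN
  intro s₀ h₀
  rw [mul_one]
  cases c with
  | real r e =>
    obtain ⟨t, s₁, h1⟩ := e.compile_computes s₀ 64 le_rfl (h.2.congr h₀)
    have h2 := h1.agree le_rfl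
    refine ⟨t + 1, _, Exec.seq h1.exec (Exec.instr rfl), ?_, ⟨?_, ?_, fun x hx => ?_⟩⟩
    · have := h1.time
      simp only [prog, Prog.cost]; omega
    · simp [apply, h1.idx, h₀.idx]
    · simp [apply, h1.mem, h₀.mem]
    · simp only [apply, State.setReg_reg, h1.value, RExpr.eval_congr h₀ h.2, h2.reg x hx,
        h₀.reg x hx]
  | cell A a e =>
    obtain ⟨t, s₁, h1⟩ := e.compile_computes s₀ 64 le_rfl (RExpr.Safe.congr h₀ h)
    have h2 := h1.agree le_rfl
    refine ⟨t + 1, _, Exec.seq h1.exec (Exec.instr rfl), ?_, ⟨?_, ?_, fun x hx => ?_⟩⟩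
    · have := h1.time
      simp only [prog, Prog.cost]; omega
    · simp [apply, h1.idx, h₀.idx]
    · simp [apply, State.setMem, h1.mem, h1.idx, h₀.mem, h₀.idx, h1.value, RExpr.eval_congr h₀ h]
    · simp [apply, h2.reg x hx, h₀.reg x hx]
  | idxConst a c =>
    exact ⟨1, _, Exec.instr rfl, le_rfl, ⟨by simp [apply, State.setIdx, h₀.idx], h₀.mem, h₀.reg⟩⟩
  | idxCopy a b =>
    exact ⟨1, _, Exec.instr rfl, le_rfl, ⟨by simp [apply, State.setIdx, h₀.idx], h₀.mem, h₀.reg⟩⟩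
  | idxAdd a b c =>
    exact ⟨1, _, Exec.instr rfl, le_rfl, ⟨by simp [apply, State.setIdx, h₀.idx], h₀.mem, h₀.reg⟩⟩
  | idxSub a b c =>
    exact ⟨1, _, Exec.instr rfl, le_rfl, ⟨by simp [apply, State.setIdx, h₀.idx], h₀.mem, h₀.reg⟩⟩

end Assign

/-- A sequence of assignments. -/
def block : List Assign → Prog
  | [] => .skip
  | c :: l => .seq c.prog (block l)

/-- The state after a sequence of assignments. -/
noncomputable def applyAll (s : State) : List Assign → State
  | [] => s
  | c :: l => applyAll (c.apply s) l

/-- All assignments of the sequence have effects that are given by `applyAll`. -/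
def SafeAll (s : State) : List Assign → Prop
  | [] => True
  | c :: l => c.Safe s ∧ SafeAll (c.apply s) l

theorem block_runs {l : List Assign} {s : State} {N : ℕ} (hN : 1 ≤ N) (h : SafeAll s l) :
    Runs (block l) N s (applyAll s l) := by
  induction l generalizing s with
  | nil => exact Runs.skip hN
  | cons c l ih => exact Runs.seq (Assign.runs hN h.1) (ih h.2)

end DKS

namespace DKS
open RExpr

/-! ### Intersecting a line with the graph of `R i` -/

/-- The line `α * x + β * y + γ = 0` meets the graph of `R j` at `x` only, and there the value of
`a * x + b * y + c` is `X`. -/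
structure Meets (d : ℕ → ℝ) (j : ℕ) (α β γ a b c X x : ℝ) : Prop where
  coeff_nonneg : 0 ≤ β
  steep : 0 < α + 2 * d j ^ 2 * β
  nonneg : 0 ≤ x
  root : α * x + β * derivQ d j x + γ = 0
  value : X = a * x + b * derivQ d j x + c

namespace Meets

variable {d : ℕ → ℝ} {i : ℕ} {α β γ a b c X x : ℝ}

/-- Substitute the point of the graph of R_{i+1} as the M-image of a point of the graph of R_i. The
steepness is multiplied by d_i / d_{i+1}, so the conditions on the line persist. -/
theorem pullM (h : Meets d (i + 1) α β γ a b c X x) (hd : 0 < d i) (hd' : 0 < d (i + 1))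
    (hx : Transfers d i (matM d i) x) :
    ∃ x₀, Meets d i (0 - β * xi d i) ((α + 4 * d (i + 1) * d (i + 1) * β) / xi d i) γ
      (0 - b * xi d i) ((a + 4 * d (i + 1) * d (i + 1) * b) / xi d i) c X x₀ := by
  have hxi : 0 < xi d i := by unfold xi; positivity
  obtain ⟨x₀, h0, rfl, h2⟩ := (transfers_matM_iff d i x).1 hx
  have hs := h.steep
  have hb := h.coeff_nonneg
  refine ⟨x₀, ?_, ?_, h0, ?_, ?_⟩
  · have : 0 ≤ 2 * d (i + 1) ^ 2 * β := by positivity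
    exact div_nonneg (by linarith) hxi.le
  · have : 0 - β * xi d i + 2 * d i ^ 2 * ((α + 4 * d (i + 1) * d (i + 1) * β) / xi d i)
        = d i / d (i + 1) * (α + 2 * d (i + 1) ^ 2 * β) := by
      unfold xi; field_simp; ring
    rw [this]
    positivity
  · refine Eq.trans ?_ h.root
    rw [h2]; field_simp; ring
  · rw [h.value, h2]; field_simp; ring

/-- The same substitution with L. The equation of the line is multiplied by -1 to keep the
coefficient of y nonnegative; the functional is not, since its value matters. -/
theorem pullL (h : Meets d (i + 1) α β γ a b c X x) (hd : 0 < d i) (hd' : 0 < d (i + 1))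
    (hx : Transfers d i (matL d i) x) :
    ∃ x₀, Meets d i (α + β * (4 * d (i + 1) * d (i + 1) + 2 * xi d i)) β
      (0 - (γ + α + β * (xi d i + 4 * d (i + 1) * d (i + 1))))
      (0 - a - b * (4 * d (i + 1) * d (i + 1) + 2 * xi d i)) (0 - b)
      (c + a + b * (xi d i + 4 * d (i + 1) * d (i + 1))) X x₀ := by
  have hxi : 0 < xi d i := by unfold xi; positivity
  obtain ⟨x₀, h0, rfl, h2⟩ := (transfers_matL_iff d i x).1 hx
  have hs := h.steep
  have hb := h.coeff_nonneg
  refine ⟨x₀, hb, ?_, h0, ?_, ?_⟩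
  · have h3 : 0 ≤ β * (2 * d (i + 1) ^ 2 + 2 * xi d i) := by positivity
    have h4 : 0 ≤ 2 * d i ^ 2 * β := by positivity
    linarith
  · have := h.root
    rw [h2] at this
    linarith
  · rw [h.value, h2]; ring

/-- The line form is strictly increasing along the graph of R_i, so its sign at a stored breakpoint
tells on which side the intersection lies. -/
theorem le_iff (h : Meets d i α β γ a b c X x) (hR : Regular d i) {y : ℝ} (hy : 0 ≤ y) :
    0 ≤ α * y + β * derivQ d i y + γ ↔ x ≤ y := by
  rw [← hR.line_le_line_iff h.coeff_nonneg h.steep h.nonneg hy]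
  have := h.root
  constructor <;> intro <;> linarith

end Meets

/-! ### Records in memory and the pull-back loop -/

/-- The records of `R 2, …, R i` and the gaps `d 1, …, d i` (in array `24`) are in memory. -/
structure Stored (d : ℕ → ℝ) (i : ℕ) (s : State) : Prop where
  gaps : ∀ j, 1 ≤ j → j ≤ i → s.mem 24 j = d j
  first : StoresFirst d s
  next : ∀ j, 2 ≤ j → j + 1 ≤ i → StoresNext d s j

/-- The state differs only in registers that the intersection routine uses. -/
structure Frame (s s' : State) : Prop where
  mem : s'.mem = s.mem
  idx : ∀ a, a ≠ 4 → a ≠ 5 → s'.idx a = s.idx a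
  reg : ∀ r, 20 ≤ r → s'.reg r = s.reg r

theorem Frame.trans {s s' s'' : State} (h : Frame s s') (h' : Frame s' s'') : Frame s s'' :=
  ⟨h'.mem.trans h.mem, fun a h1 h2 => (h'.idx a h1 h2).trans (h.idx a h1 h2),
    fun r hr => (h'.reg r hr).trans (h.reg r hr)⟩

theorem StoresFirst.congr {d : ℕ → ℝ} {s s' : State} (h : StoresFirst d s)
    (h3 : s'.mem 3 2 = s.mem 3 2) (h4 : s'.mem 4 2 = s.mem 4 2)
    (h23 : ∀ k, s'.mem 23 k = s.mem 23 k) : StoresFirst d s' := by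
  obtain ⟨a1, a2, a3, a4⟩ := h
  unfold State.breakX State.breakY at *
  constructor <;> simp only [State.breakX, State.breakY, h3, h4, h23] <;> assumption

theorem StoresNext.congr {d : ℕ → ℝ} {s s' : State} {i : ℕ} (h : StoresNext d s i)
    (hm : ∀ A, 2 ≤ A → A ≤ 22 → s'.mem A (i + 1) = s.mem A (i + 1)) : StoresNext d s' i := by
  have hM : s'.storedM (i + 1) = s.storedM (i + 1) := by
    ext a b; exact hm _ (by omega) (by omega)
  have hL : s'.storedL (i + 1) = s.storedL (i + 1) := by
    ext a b; exact hm _ (by omega) (by omega)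
  have h2 : s'.flag (i + 1) = s.flag (i + 1) := hm 2 (by omega) (by omega)
  have h3 : s'.breakX (i + 1) = s.breakX (i + 1) := hm 3 (by omega) (by omega)
  have h4 : s'.breakY (i + 1) = s.breakY (i + 1) := hm 4 (by omega) (by omega)
  unfold StoresNext at *
  rwa [hM, hL, h2, h3, h4]

/-- Records up to R_i occupy only positions up to i of the arrays 2 to 22, so writing the record of
R_{i+1} or a weight leaves them intact. -/
theorem Stored.congr {d : ℕ → ℝ} {i : ℕ} {s s' : State} (h : Stored d i s) (hi : 2 ≤ i)
    (hm : ∀ A k, 2 ≤ A → k ≤ i ∨ 22 < A → s'.mem A k = s.mem A k) : Stored d i s' where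
  gaps j h1 h2 := by
    rw [hm 24 j (by omega) (by omega)]; exact h.gaps j h1 h2
  first := h.first.congr (hm 3 2 (by omega) (by omega)) (hm 4 2 (by omega) (by omega))
    fun k => hm 23 k (by omega) (by omega)
  next j h1 h2 := (h.next j h1 h2).congr fun A h3 h4 => hm A _ h3 (by omega)

/-- Load `d (i + 1)`, `d i`, `ξ i` into the registers `10`, `11`, `12`, where the index register
`4` holds `i + 1`, and into the register `16` the value of the line at the breakpoint of
`R (i + 1)`, or `-1` if there is none. -/
def pullLoad : List Assign :=
  [.real 10 (arr 24 4), .real 13 (arr 2 4), .real 14 (arr 3 4), .real 15 (arr 4 4),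
    .real 16 (reg 13 * (reg 0 * reg 14 + reg 1 * reg 15 + reg 2 + 1) - 1), .real 17 0,
    .idxSub 4 4 1, .real 11 (arr 24 4), .real 12 (2 * reg 11 * reg 10)]

/-- Pull the line and the functional back under the matrix `L`. -/
def pullUnderL : List Assign :=
  [.real 2 (0 - (reg 2 + reg 0 + reg 1 * (reg 12 + 4 * reg 10 * reg 10))),
    .real 0 (reg 0 + reg 1 * (4 * reg 10 * reg 10 + 2 * reg 12)),
    .real 5 (reg 5 + reg 3 + reg 4 * (reg 12 + 4 * reg 10 * reg 10)),
    .real 3 (0 - reg 3 - reg 4 * (4 * reg 10 * reg 10 + 2 * reg 12)),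
    .real 4 (0 - reg 4)]

/-- Pull the line and the functional back under the matrix `M`. -/
def pullUnderM : List Assign :=
  [.real 18 (0 - reg 1 * reg 12),
    .real 1 ((reg 0 + 4 * reg 10 * reg 10 * reg 1) / reg 12),
    .real 0 (reg 18),
    .real 18 (0 - reg 4 * reg 12),
    .real 4 ((reg 3 + 4 * reg 10 * reg 10 * reg 4) / reg 12),
    .real 3 (reg 18)]

/-- Pull the line and the functional back from the graph of `R (i + 1)` to that of `R i`. -/
def pullStep : Prog :=
  .seq (block pullLoad) (.ite (.realLe 17 16) (block pullUnderL) (block pullUnderM))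

/-- The line in the registers `0`, `1`, `2` meets the graph of `R j`, and the functional in the
registers `3`, `4`, `5` has the value `X` there. -/
def LineMeets (d : ℕ → ℝ) (j : ℕ) (X : ℝ) (s : State) : Prop :=
  ∃ x, Meets d j (s.reg 0) (s.reg 1) (s.reg 2) (s.reg 3) (s.reg 4) (s.reg 5) X x

theorem pullStep_runs {d : ℕ → ℝ} {i m : ℕ} {X : ℝ} {s : State} (hi : 2 ≤ i) (him : i + 1 ≤ m)
    (hd : ∀ j, 1 ≤ j → j ≤ m → 0 < d j) (hs : Stored d m s) (h1 : s.idx 1 = 1)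
    (h4 : s.idx 4 = i + 1) (hX : LineMeets d (i + 1) X s) :
    ∃ s', Runs pullStep 1 s s' ∧ LineMeets d i X s' ∧ s'.idx 4 = i ∧ Frame s s' := by
  have hdi := hd i (by omega) (by omega)
  have hdi' := hd (i + 1) (by omega) him
  have hxi : 0 < xi d i := by unfold xi; positivity
  have hR := regular (show 2 ≤ i + 1 by omega) fun j h1 h2 => hd j h1 (by omega)
  obtain ⟨x, hx⟩ := hX
  set s1 := applyAll s pullLoad with hs1
  have hrun1 : Runs (block pullLoad) 1 s s1 :=
    block_runs le_rfl (by simp [SafeAll, pullLoad, Assign.Safe])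
  have e4 : s1.idx 4 = i := by simp [s1, pullLoad, applyAll, Assign.apply, h4, h1]
  have e10 : s1.reg 10 = d (i + 1) := by
    simp [s1, pullLoad, applyAll, Assign.apply, h4, hs.gaps (i + 1) (by omega) him]
  have e12 : s1.reg 12 = xi d i := by
    simp [s1, pullLoad, applyAll, Assign.apply, h4, h1, hs.gaps (i + 1) (by omega) him,
      hs.gaps i (by omega) (by omega), xi]
  have e17 : s1.reg 17 = 0 := by simp [s1, pullLoad, applyAll, Assign.apply]
  -- With flag 0 this equals -1, which selects M; with flag 1 it is the line form at the breakpoint.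
  -- One test covers both cases.
  have e16 : s1.reg 16 = s.flag (i + 1) * (s.reg 0 * s.breakX (i + 1) + s.reg 1 * s.breakY (i + 1)
      + s.reg 2 + 1) - 1 := by
    simp [s1, pullLoad, applyAll, Assign.apply, h4, State.flag, State.breakX, State.breakY]
  have elow : ∀ r, r < 6 → s1.reg r = s.reg r := by
    intro r hr
    interval_cases r <;> simp [s1, pullLoad, applyAll, Assign.apply]
  have hframe1 : Frame s s1 := by
    refine ⟨by simp [s1, pullLoad, applyAll, Assign.apply], fun a h1 h2 => ?_, fun r hr => ?_⟩
    · simp [s1, pullLoad, applyAll, Assign.apply, h1]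
    · have : ∀ k, k < 20 → r ≠ k := fun k hk => by omega
      simp [s1, pullLoad, applyAll, Assign.apply, this]
  have caseL : 0 ≤ s1.reg 16 → Transfers d i (matL d i) x → ∃ s', Runs pullStep 1 s s' ∧
      LineMeets d i X s' ∧ s'.idx 4 = i ∧ Frame s s' := by
    intro hc ht
    refine ⟨applyAll s1 pullUnderL, hrun1.seq (Runs.iteTrue ⟨by decide, by decide⟩
      (by simpa [Test.Holds, e17] using hc) le_rfl
      (block_runs le_rfl (by simp [SafeAll, pullUnderL, Assign.Safe]))), ?_, ?_,
      hframe1.trans ⟨?_, fun a h1 h2 => ?_, fun r hr => ?_⟩⟩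
    · simpa [LineMeets, pullUnderL, applyAll, Assign.apply, e10, e12, elow]
        using hx.pullL hdi hdi' ht
    · simpa [pullUnderL, applyAll, Assign.apply] using e4
    · simp [pullUnderL, applyAll, Assign.apply]
    · simp [pullUnderL, applyAll, Assign.apply]
    · have : ∀ k, k < 20 → r ≠ k := fun k hk => by omega
      simp [pullUnderL, applyAll, Assign.apply, this]
  have caseM : s1.reg 16 < 0 → Transfers d i (matM d i) x → ∃ s', Runs pullStep 1 s s' ∧
      LineMeets d i X s' ∧ s'.idx 4 = i ∧ Frame s s' := by
    intro hc ht
    refine ⟨applyAll s1 pullUnderM, hrun1.seq (Runs.iteFalse ⟨by decide, by decide⟩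
      (by simpa [Test.Holds, e17] using hc) le_rfl
      (block_runs le_rfl
        (by simp [SafeAll, pullUnderM, Assign.Safe, Assign.apply, e12, hxi.ne']))), ?_, ?_,
      hframe1.trans ⟨?_, fun a h1 h2 => ?_, fun r hr => ?_⟩⟩
    · simpa [LineMeets, pullUnderM, applyAll, Assign.apply, e10, e12, elow]
        using hx.pullM hdi hdi' ht
    · simpa [pullUnderM, applyAll, Assign.apply] using e4
    · simp [pullUnderM, applyAll, Assign.apply]
    · simp [pullUnderM, applyAll, Assign.apply]
    · have : ∀ k, k < 20 → r ≠ k := fun k hk => by omega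
      simp [pullUnderM, applyAll, Assign.apply, this]
  obtain ⟨hM, ⟨-, hf, ht⟩ | ⟨-, hf, hL, hb0, -, hby, htL, htM⟩⟩ := hs.next i hi him
  · rw [hM] at ht
    exact caseM (by rw [e16, hf]; norm_num) (ht x hx.nonneg)
  · rw [hL] at htL
    rw [hM] at htM
    have e16' : s1.reg 16 = s.reg 0 * s.breakX (i + 1)
        + s.reg 1 * derivQ d (i + 1) (s.breakX (i + 1)) + s.reg 2 := by
      rw [e16, hf, hby]; ring
    have hiff := hx.le_iff hR hb0.le
    rw [← e16'] at hiff
    rcases le_or_gt 0 (s1.reg 16) with hc | hc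
    · exact caseL hc (htL x hx.nonneg (hiff.1 hc))
    · exact caseM hc (htM x (le_of_lt (not_le.1 (mt hiff.2 hc.not_ge))))

/-- Load the breakpoint of `R 2` and the value of the line there. -/
def solveLoad : List Assign :=
  [.real 14 (arr 3 4), .real 15 (arr 4 4), .real 16 (reg 0 * reg 14 + reg 1 * reg 15 + reg 2),
    .real 17 0]

/-- Load the coefficients in the positions `k` and `k + 1` of the array `23`. -/
def solvePiece (k : ℕ) : List Assign :=
  [.idxConst 5 k, .real 18 (arr 23 5), .idxConst 5 (k + 1), .real 19 (arr 23 5)]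

/-- Intersect the line with the graph of a linear function and evaluate the functional. -/
def solveLinear : List Assign :=
  [.real 7 ((0 - (reg 1 * reg 19 + reg 2)) / (reg 0 + reg 1 * reg 18)),
    .real 6 (reg 3 * reg 7 + reg 4 * (reg 18 * reg 7 + reg 19) + reg 5)]

/-- Intersect the line with the graph of `R 2` and evaluate the functional. -/
def solve : Prog :=
  .seq (block solveLoad)
    (.seq (.ite (.realLe 17 16) (block (solvePiece 0)) (block (solvePiece 2))) (block solveLinear))

/-- The sign at the breakpoint selects the linear piece of R_2 that contains the intersection, and
one linear equation remains. -/
theorem solve_runs {d : ℕ → ℝ} {X : ℝ} {s : State} (h1 : 0 < d 1) (h2 : 0 < d 2)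
    (hs : StoresFirst d s) (h4 : s.idx 4 = 2) (hX : LineMeets d 2 X s) :
    ∃ s', Runs solve 1 s s' ∧ s'.reg 6 = X ∧ Frame s s' := by
  have hR : Regular d 2 := (regular_two h1 h2).1
  obtain ⟨x, hx⟩ := hX
  obtain ⟨hb, hby, hlo, hhi⟩ := hs
  set s1 := applyAll s solveLoad with hs1
  have hrun1 : Runs (block solveLoad) 1 s s1 :=
    block_runs le_rfl (by simp [SafeAll, solveLoad, Assign.Safe])
  have e17 : s1.reg 17 = 0 := by simp [s1, solveLoad, applyAll, Assign.apply]
  have e16 : s1.reg 16 = s.reg 0 * s.breakX 2 + s.reg 1 * derivQ d 2 (s.breakX 2) + s.reg 2 := by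
    rw [← hby]
    simp [s1, solveLoad, applyAll, Assign.apply, h4, State.breakX, State.breakY]
  have elow : ∀ r, r < 6 → s1.reg r = s.reg r := by
    intro r hr
    interval_cases r <;> simp [s1, solveLoad, applyAll, Assign.apply]
  have hframe1 : Frame s s1 := by
    refine ⟨by simp [s1, solveLoad, applyAll, Assign.apply], fun a h1 h2 => ?_, fun r hr => ?_⟩
    · simp [s1, solveLoad, applyAll, Assign.apply]
    · have : ∀ k, k < 20 → r ≠ k := fun k hk => by omega
      simp [s1, solveLoad, applyAll, Assign.apply, this]
  have piece : ∀ k, Runs (.ite (.realLe 17 16) (block (solvePiece 0)) (block (solvePiece 2))) 1 s1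
      (applyAll s1 (solvePiece k)) → 2 * d 2 ^ 2 ≤ s.mem 23 k →
      derivQ d 2 x = s.mem 23 k * x + s.mem 23 (k + 1) →
      ∃ s', Runs solve 1 s s' ∧ s'.reg 6 = X ∧ Frame s s' := by
    intro k hrun2 hk hRx
    set s2 := applyAll s1 (solvePiece k) with hs2
    have e18 : s2.reg 18 = s.mem 23 k := by
      simp [s2, solvePiece, applyAll, Assign.apply, hframe1.mem]
    have e19 : s2.reg 19 = s.mem 23 (k + 1) := by
      simp [s2, solvePiece, applyAll, Assign.apply, hframe1.mem]
    have elow2 : ∀ r, r < 6 → s2.reg r = s.reg r := by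
      intro r hr
      rw [← elow r hr]
      interval_cases r <;> simp [s2, solvePiece, applyAll, Assign.apply]
    have hframe2 : Frame s1 s2 := by
      refine ⟨by simp [s2, solvePiece, applyAll, Assign.apply], fun a h1 h2 => ?_, fun r hr => ?_⟩
      · simp [s2, solvePiece, applyAll, Assign.apply, h2]
      · have : ∀ k, k < 20 → r ≠ k := fun k hk => by omega
        simp [s2, solvePiece, applyAll, Assign.apply, this]
    -- The selected piece has slope at least 2 d_2², so steepness of the line makes the divisor
    -- positive.
    have hpos : 0 < s.reg 0 + s.reg 1 * s.mem 23 k := by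
      have := hx.steep
      nlinarith [mul_le_mul_of_nonneg_left hk hx.coeff_nonneg]
    have hroot := hx.root
    rw [hRx] at hroot
    have hxeq : (0 - (s.reg 1 * s.mem 23 (k + 1) + s.reg 2)) / (s.reg 0 + s.reg 1 * s.mem 23 k)
        = x := by
      rw [div_eq_iff hpos.ne']; linarith
    refine ⟨applyAll s2 solveLinear, hrun1.seq (hrun2.seq (block_runs le_rfl ?_)), ?_,
      hframe1.trans (hframe2.trans ⟨?_, fun a h1 h2 => ?_, fun r hr => ?_⟩)⟩
    · simp [SafeAll, solveLinear, Assign.Safe, e18, elow2, hpos.ne']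
    · have hv := hx.value
      rw [hRx] at hv
      simp only [zero_sub] at hxeq
      simp [solveLinear, applyAll, Assign.apply, e18, e19, elow2, hxeq, hv,
        -neg_add_rev]
    · simp [solveLinear, applyAll, Assign.apply]
    · simp [solveLinear, applyAll, Assign.apply]
    · have : ∀ k, k < 20 → r ≠ k := fun k hk => by omega
      simp [solveLinear, applyAll, Assign.apply, this]
  have hiff := hx.le_iff hR hb.le
  rw [← e16] at hiff
  rcases le_or_gt 0 (s1.reg 16) with hc | hc
  · refine piece 0 (Runs.iteTrue ⟨by decide, by decide⟩ (by simpa [Test.Holds, e17] using hc) le_rfl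
      (block_runs le_rfl (by simp [SafeAll, solvePiece, Assign.Safe]))) ?_
      (hlo x hx.nonneg (hiff.1 hc))
    -- The slope of the piece is read off from its values at 0 and at the breakpoint; the other
    -- piece uses the breakpoint and the point one unit to its right.
    have h := hR.slope le_rfl hb.le
    rw [hlo _ hb.le le_rfl, hlo 0 le_rfl hb.le] at h
    refine le_of_mul_le_mul_right ?_ hb
    linarith
  · refine piece 2 (Runs.iteFalse ⟨by decide, by decide⟩ (by simpa [Test.Holds, e17] using hc)
      le_rfl (block_runs le_rfl (by simp [SafeAll, solvePiece, Assign.Safe]))) ?_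
      (hhi x (le_of_lt (not_le.1 (mt hiff.2 hc.not_ge))))
    have h := hR.slope hb.le (show s.breakX 2 ≤ s.breakX 2 + 1 by linarith)
    rw [hhi _ le_rfl, hhi _ (by linarith)] at h
    linarith

/-- Intersect the line in the registers `0`, `1`, `2` with the graph of `R i`, where the index
register `4` holds `i`, and leave the first coordinate of the intersection in the register `6`. -/
def intersect : Prog :=
  .seq (block [.real 3 1, .real 4 0, .real 5 0]) (.seq (.loop (.idxLt 2 4) pullStep) solve)

/-- The functional starts as (1, 0, 0), the abscissa itself, so its value after all pull-backs is
the abscissa on the original graph. Each of the i - 2 levels takes boundedly many steps, which is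
why the bound is linear in i. -/
theorem intersect_runs {d : ℕ → ℝ} {i m N : ℕ} {x : ℝ} {s : State} (hi : 2 ≤ i) (him : i ≤ m)
    (hN : i ≤ N) (hd : ∀ j, 1 ≤ j → j ≤ m → 0 < d j) (hs : Stored d m s) (h1 : s.idx 1 = 1)
    (h2 : s.idx 2 = 2) (h4 : s.idx 4 = i) (hα : 0 ≤ s.reg 0) (hβ : s.reg 1 = 1) (hx : 0 ≤ x)
    (hroot : s.reg 0 * x + derivQ d i x + s.reg 2 = 0) :
    ∃ s', Runs intersect N s s' ∧ s'.reg 6 = x ∧ Frame s s' := by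
  set s1 := applyAll s [.real 3 1, .real 4 0, .real 5 0] with hs1
  have hrun1 : Runs (block [.real 3 1, .real 4 0, .real 5 0]) N s s1 :=
    block_runs (by omega) (by simp [SafeAll, Assign.Safe])
  have hframe1 : Frame s s1 := by
    refine ⟨by simp [s1, applyAll, Assign.apply], fun a h1 h2 => ?_, fun r hr => ?_⟩
    · simp [s1, applyAll, Assign.apply]
    · have : ∀ k, k < 20 → r ≠ k := fun k hk => by omega
      simp [s1, applyAll, Assign.apply, this]
  have hmeet : LineMeets d i x s1 := by
    have hdi := hd i (by omega) him
    refine ⟨x, ?_⟩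
    simp only [s1, applyAll, Assign.apply, State.setReg_reg, eval_one, eval_zero]
    norm_num
    rw [hβ]
    exact ⟨zero_le_one, by positivity, hx, by linarith, by ring⟩
  let I : ℕ → State → Prop := fun k t => t.idx 4 = k + 2 ∧ k + 2 ≤ m ∧ LineMeets d (k + 2) x t ∧
    Frame s t
  have hloop := Runs.loop (P := pullStep) (b := .idxLt 2 4) (N := 1) trivial I ?_ ?_ le_rfl
    (i - 2) s1 ⟨?_, by omega, ?_, hframe1⟩
  · obtain ⟨s2, hrun2, h24, -, hmeet2, hframe2⟩ := hloop
    have hstored2 : StoresFirst d s2 :=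
      (hs.congr (by omega) fun A k _ _ => by rw [hframe2.mem]).first
    obtain ⟨s3, hrun3, h36, hframe3⟩ := solve_runs (hd 1 le_rfl (by omega))
      (hd 2 (by omega) (by omega)) hstored2 h24 hmeet2
    exact ⟨s3, hrun1.seq ((hrun2.mono (by omega)).seq (hrun3.mono (by omega))), h36,
      hframe2.trans hframe3⟩
  · rintro k t ⟨ht4, htm, htX, htF⟩
    have ht1 : t.idx 1 = 1 := by rw [htF.idx 1 (by decide) (by decide), h1]
    have ht2 : t.idx 2 = 2 := by rw [htF.idx 2 (by decide) (by decide), h2]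
    refine ⟨?_, ?_⟩
    · simp only [Test.Holds, ht2, ht4]; omega
    · obtain ⟨t', h1', h2', h3', h4'⟩ := pullStep_runs (i := k + 2) (by omega) htm hd
        (hs.congr (by omega) fun A k _ _ => by rw [htF.mem]) ht1 ht4 htX
      exact ⟨t', h1', h3', by omega, h2', htF.trans h4'⟩
  · rintro t ⟨ht4, -, -, htF⟩
    have ht2 : t.idx 2 = 2 := by rw [htF.idx 2 (by decide) (by decide), h2]
    simp only [Test.Holds, ht2, ht4]; omega
  · simp [s1, applyAll, Assign.apply, h4]; omega
  · rw [show i - 2 + 2 = i by omega]; exact hmeet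

end DKS

namespace DKS
open RExpr Set

/-! ### The program -/

/-- Compute a gap. -/
def gapStep : Prog :=
  block [.idxAdd 4 3 1, .cell 24 3 (arr 0 4 - arr 0 3), .idxCopy 3 4]

/-- Store `R 2` and prepare the index registers. -/
def storeFirst : List Assign :=
  [.real 20 (arr 24 1), .real 21 (arr 24 2), .cell 3 2 (2 * reg 20 / reg 21),
    .cell 4 2 (6 * reg 20 * reg 21),
    .idxConst 5 0, .cell 23 5 (4 * reg 21 * reg 21),
    .idxConst 5 1, .cell 23 5 (0 - 2 * reg 20 * reg 21),
    .idxConst 5 2, .cell 23 5 (3 * reg 21 * reg 21),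
    .idxConst 5 3, .cell 23 5 0,
    .idxConst 3 2, .idxSub 6 0 1]

/-- Find the zero of `R i`, where the index register `3` holds `i`. -/
def findZero : Prog :=
  .seq (block [.idxCopy 4 3, .real 0 0, .real 1 1, .real 2 0]) intersect

/-- Store the matrix `M (i + 1)`. -/
def storeM : List Assign :=
  [.idxAdd 7 3 1, .real 21 (arr 24 3), .real 22 (arr 24 7), .real 20 (2 * reg 21 * reg 22),
    .cell 14 7 0, .cell 15 7 (1 / reg 20), .cell 16 7 0,
    .cell 17 7 (0 - reg 20), .cell 18 7 (4 * reg 22 * reg 22 / reg 20), .cell 19 7 0,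
    .cell 20 7 0, .cell 21 7 0, .cell 22 7 1, .real 23 1]

/-- Store the flag, the breakpoint of `R (i + 1)` and the matrix `L (i + 1)`. -/
def storeL : List Assign :=
  [.real 24 (1 - reg 6), .cell 2 7 1, .cell 3 7 (reg 24),
    .cell 4 7 (4 * reg 22 * reg 22 * reg 24 - reg 20 * reg 6),
    .cell 5 7 (0 - 1), .cell 6 7 0, .cell 7 7 1,
    .cell 8 7 (0 - 2 * reg 20 - 4 * reg 22 * reg 22), .cell 9 7 (0 - 1),
    .cell 10 7 (reg 20 + 4 * reg 22 * reg 22),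
    .cell 11 7 0, .cell 12 7 0, .cell 13 7 1]

/-- Find the breakpoint of `R (i + 1)` and store it. -/
def storeBreak : Prog :=
  .seq (block [.idxCopy 4 3, .real 0 (reg 20), .real 1 1, .real 2 (0 - reg 20)])
    (.seq intersect (block storeL))

/-- Store the record of `R (i + 1)`, where the index register `3` holds `i`. -/
def buildStep : Prog :=
  .seq findZero (.seq (block storeM)
    (.seq (.ite (.realLt 6 23) storeBreak (block [.cell 2 7 0])) (block [.idxAdd 3 3 1])))

/-- Store the maximum of the registers `6` and `23` as the weight whose index is in the index
register `3`. -/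
def storeMax : Prog :=
  .seq (.ite (.realLt 6 23) (block [.real 6 (reg 23)]) .skip) (block [.cell 1 3 (reg 6)])

/-- Compute the last weight. -/
def lastWeight : Prog := .seq findZero (.seq (block [.real 23 1]) storeMax)

/-- Compute a weight from the next one. -/
def backStep : Prog :=
  .seq (block [.idxCopy 7 3, .idxSub 3 3 1, .real 25 (arr 1 7), .real 20 (2 * arr 24 3 * arr 24 7),
      .idxCopy 4 3, .real 0 0, .real 1 1, .real 2 (0 - reg 20 * reg 25)])
    (.seq intersect (.seq (block [.real 23 (1 - reg 25)]) storeMax))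

/-- Compute the first weight. -/
def firstWeight : Prog :=
  .seq (block [.real 6 (arr 24 2 / (2 * arr 24 1) * arr 1 2), .real 23 1, .idxConst 3 1]) storeMax

/-- The computation for at least three points. -/
def computeWeights : Prog :=
  .seq (.loop (.idxLt 3 0) gapStep)
    (.seq (block storeFirst)
      (.seq (.loop (.idxLt 3 6) buildStep)
        (.seq lastWeight (.seq (.loop (.idxLt 2 3) backStep) firstWeight))))

/-- The whole program. -/
def optimalWeights : Prog :=
  .seq (block [.idxConst 1 1, .idxConst 2 2, .idxConst 3 1])
    (.ite (.idxLe 0 2) (block [.cell 1 1 1]) computeWeights)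

/-! ### Correctness of the program -/

/-- The index registers that hold constants, and the gaps. -/
structure Ready (n : ℕ) (d : ℕ → ℝ) (s : State) : Prop where
  idx0 : s.idx 0 = n
  idx1 : s.idx 1 = 1
  idx2 : s.idx 2 = 2
  gaps : ∀ j, 1 ≤ j → j + 1 ≤ n → s.mem 24 j = d j

theorem gapLoop_runs {n : ℕ} (hn : 1 ≤ n) {p : ℕ → ℝ} {s : State} (h0 : s.idx 0 = n)
    (h1 : s.idx 1 = 1) (h2 : s.idx 2 = 2) (h3 : s.idx 3 = 1)
    (hp : ∀ j, 1 ≤ j → j ≤ n → s.mem 0 j = p j) :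
    ∃ s', Runs (.loop (.idxLt 3 0) gapStep) (1 * (n - 1 + 1)) s s' ∧ Ready n (gap p) s' := by
  let I : ℕ → State → Prop := fun k t => t.idx 3 + k = n ∧ 1 ≤ t.idx 3 ∧ t.idx 0 = n ∧
    t.idx 1 = 1 ∧ t.idx 2 = 2 ∧ (∀ j, 1 ≤ j → j ≤ n → t.mem 0 j = p j) ∧
    ∀ j, 1 ≤ j → j < t.idx 3 → t.mem 24 j = gap p j
  have hloop := Runs.loop (P := gapStep) (b := .idxLt 3 0)
    (N := 1) trivial I ?_ ?_ le_rfl (n - 1) s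
    ⟨by omega, by omega, h0, h1, h2, hp, fun j _ _ => by omega⟩
  · obtain ⟨s', hrun, e3, -, e0, e1, e2, -, eg⟩ := hloop
    exact ⟨s', hrun, e0, e1, e2, fun j hj hjn => eg j hj (by omega)⟩
  · rintro k t ⟨e3, e3', e0, e1, e2, ep, eg⟩
    refine ⟨?_, _, block_runs le_rfl (by simp [SafeAll, Assign.Safe]), ?_⟩
    · simp only [Test.Holds]; omega
    · simp only [I, applyAll, Assign.apply, State.setIdx_idx, State.setMem_mem, State.setIdx_mem,
        State.setMem_idx, eval_sub, eval_arr]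
      norm_num
      refine ⟨by omega, by omega, e0, e1, e2, ep, fun j hj hj' => ?_⟩
      rw [e1] at *
      split_ifs with hje
      · subst hje
        rw [ep _ (by omega) (by omega), ep _ (by omega) (by omega), gap]
      · exact eg j hj (by omega)
  · rintro t ⟨e3, -, e0, -⟩
    simp only [Test.Holds]; omega

/-- The optimal first weight max(d_2 x / (2 d_1), 1) switches at x = 2 d_1 / d_2. Inserting its two
branches in the formula for R_2 gives the stored coefficients and the value 6 d_1 d_2 there. -/
theorem storeFirst_runs {n : ℕ} (hn : 3 ≤ n) {d : ℕ → ℝ} (hd : ∀ j, 1 ≤ j → j + 1 ≤ n → 0 < d j)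
    {s : State} (hs : Ready n d s) :
    ∃ s', Runs (block storeFirst) 1 s s' ∧ Ready n d s' ∧ Stored d 2 s' ∧ s'.idx 3 = 2 ∧
      s'.idx 6 = n - 1 := by
  have h1 := hd 1 le_rfl (by omega)
  have h2 := hd 2 (by omega) (by omega)
  have g1 := hs.gaps 1 le_rfl (by omega)
  have g2 := hs.gaps 2 (by omega) (by omega)
  have hstep := (regular_two h1 h2).2
  set s' := applyAll s storeFirst with hs'
  have eX : s'.breakX 2 = 2 * d 1 / d 2 := by
    simp [s', storeFirst, applyAll, Assign.apply, State.breakX, hs.idx1, hs.idx2, g1, g2]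
  have eY : s'.breakY 2 = 6 * d 1 * d 2 := by
    simp [s', storeFirst, applyAll, Assign.apply, State.breakY, hs.idx1, hs.idx2, g1, g2]
  have c0 : s'.mem 23 0 = 4 * d 2 * d 2 := by
    simp [s', storeFirst, applyAll, Assign.apply, hs.idx1, hs.idx2, g1, g2]
  have c1 : s'.mem 23 1 = -(2 * d 1 * d 2) := by
    simp [s', storeFirst, applyAll, Assign.apply, hs.idx1, hs.idx2, g1, g2]
  have c2 : s'.mem 23 2 = 3 * d 2 * d 2 := by
    simp [s', storeFirst, applyAll, Assign.apply, hs.idx1, hs.idx2, g1, g2]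
  have c3 : s'.mem 23 3 = 0 := by
    simp [s', storeFirst, applyAll, Assign.apply]
  have hX : 0 < s'.breakX 2 := by rw [eX]; positivity
  have hbelow : ∀ x, 0 ≤ x → x ≤ s'.breakX 2 →
      derivQ d 2 x = s'.mem 23 0 * x + s'.mem 23 1 := by
    intro x hx hxX
    rw [eX, le_div_iff₀ h2] at hxX
    rw [(hstep x hx 1 (max_eq_right ?_).symm).2, c0, c1, xi]
    · ring
    · rw [div_mul_eq_mul_div, div_le_one (by positivity)]; linarith
  have habove : ∀ x, s'.breakX 2 ≤ x → derivQ d 2 x = s'.mem 23 2 * x + s'.mem 23 3 := by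
    intro x hxX
    have hx : 0 ≤ x := hX.le.trans hxX
    rw [eX, div_le_iff₀ h2] at hxX
    rw [(hstep x hx _ (max_eq_left ?_).symm).2, c2, c3, xi]
    · field_simp; ring
    · rw [div_mul_eq_mul_div, le_div_iff₀ (by positivity)]; linarith
  have hgaps : ∀ j, s'.mem 24 j = s.mem 24 j := by
    intro j
    simp [s', storeFirst, applyAll, Assign.apply]
  refine ⟨s', block_runs le_rfl ?_, ⟨?_, ?_, ?_, fun j hj hjn => ?_⟩,
    ⟨fun j hj hj2 => ?_, ⟨hX, ?_, hbelow, habove⟩, fun j hj hj2 => by omega⟩, ?_, ?_⟩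
  · simp [SafeAll, storeFirst, Assign.Safe, Assign.apply, hs.idx2, g2, h2.ne']
  · simp [s', storeFirst, applyAll, Assign.apply, hs.idx0]
  · simp [s', storeFirst, applyAll, Assign.apply, hs.idx1]
  · simp [s', storeFirst, applyAll, Assign.apply, hs.idx2]
  · rw [hgaps]; exact hs.gaps j hj hjn
  · rw [hgaps]; exact hs.gaps j hj (by omega)
  · rw [hbelow _ hX.le le_rfl, c0, c1, eX, eY]; field_simp; ring
  · simp [s', storeFirst, applyAll, Assign.apply]
  · simp [s', storeFirst, applyAll, Assign.apply, hs.idx0, hs.idx1]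

theorem findZero_runs {n i N : ℕ} {d : ℕ → ℝ} (hd : ∀ j, 1 ≤ j → j + 1 ≤ n → 0 < d j) (hi : 2 ≤ i)
    (hin : i + 1 ≤ n) (hN : i ≤ N) {s : State} (hs : Ready n d s) (hst : Stored d i s)
    (h3 : s.idx 3 = i) {u : ℝ} (hu : IsInvR d i 0 u) :
    ∃ s', Runs findZero N s s' ∧ s'.reg 6 = u ∧ Frame s s' := by
  set s1 := applyAll s [.idxCopy 4 3, .real 0 0, .real 1 1, .real 2 0] with hs1
  have hrun1 : Runs (block [.idxCopy 4 3, .real 0 0, .real 1 1, .real 2 0]) N s s1 :=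
    block_runs (by omega) (by simp [SafeAll, Assign.Safe])
  have hframe1 : Frame s s1 := by
    refine ⟨by simp [s1, applyAll, Assign.apply], fun a h1 h2 => ?_, fun r hr => ?_⟩
    · simp [s1, applyAll, Assign.apply, h1]
    · have : ∀ k, k < 20 → r ≠ k := fun k hk => by omega
      simp [s1, applyAll, Assign.apply, this]
  obtain ⟨s2, hrun2, e6, hframe2⟩ := intersect_runs (s := s1) (x := u) hi le_rfl hN
    (fun j h1 h2 => hd j h1 (by omega)) (hst.congr hi fun A k _ _ => by rw [hframe1.mem])
    (by rw [hframe1.idx 1 (by decide) (by decide), hs.idx1])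
    (by rw [hframe1.idx 2 (by decide) (by decide), hs.idx2])
    (by simp [s1, applyAll, Assign.apply, h3])
    (by simp [s1, applyAll, Assign.apply]) (by simp [s1, applyAll, Assign.apply]) hu.1
    (by simp [s1, applyAll, Assign.apply, hu.2])
  exact ⟨s2, hrun1.seq hrun2, e6, hframe1.trans hframe2⟩

theorem storeM_runs {n i : ℕ} {d : ℕ → ℝ} (hd : ∀ j, 1 ≤ j → j + 1 ≤ n → 0 < d j) (hi : 2 ≤ i)
    (hin : i + 2 ≤ n) {s : State} (hs : Ready n d s) (h3 : s.idx 3 = i) :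
    ∃ s', Runs (block storeM) 1 s s' ∧ s'.storedM (i + 1) = matM d i ∧
      (∀ A k, A < 14 ∨ 22 < A ∨ k ≠ i + 1 → s'.mem A k = s.mem A k) ∧
      (∀ a, a ≠ 7 → s'.idx a = s.idx a) ∧ s'.idx 7 = i + 1 ∧ s'.reg 6 = s.reg 6 ∧
      s'.reg 20 = xi d i ∧ s'.reg 22 = d (i + 1) ∧ s'.reg 23 = 1 := by
  have hdi := hd i (by omega) (by omega)
  have hdi' := hd (i + 1) (by omega) (by omega)
  have g1 := hs.gaps i (by omega) (by omega)
  have g2 := hs.gaps (i + 1) (by omega) (by omega)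
  refine ⟨applyAll s storeM, block_runs le_rfl ?_, ?_, fun A k hA => ?_, fun a ha => ?_, ?_, ?_, ?_,
    ?_, ?_⟩
  · simp [SafeAll, storeM, Assign.Safe, Assign.apply, hs.idx1, h3, g1, g2, hdi.ne', hdi'.ne']
  · ext a b
    fin_cases a <;> fin_cases b <;>
      simp [storeM, applyAll, Assign.apply, State.storedM, matM, hs.idx1, h3, g1, g2, xi, pow_two,
        mul_assoc]
  · by_cases hk : k = i + 1
    · have : ∀ B, 14 ≤ B → B ≤ 22 → A ≠ B := fun B h1 h2 => by omega
      simp [storeM, applyAll, Assign.apply, this]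
    · simp [storeM, applyAll, Assign.apply, hs.idx1, h3, hk]
  · simp [storeM, applyAll, Assign.apply, ha]
  · simp [storeM, applyAll, Assign.apply, hs.idx1, h3]
  · simp [storeM, applyAll, Assign.apply]
  · simp [storeM, applyAll, Assign.apply, hs.idx1, h3, g1, g2, xi]
  · simp [storeM, applyAll, Assign.apply, hs.idx1, h3, g2]
  · simp [storeM, applyAll, Assign.apply]

theorem storeBreak_runs {n i N : ℕ} {d : ℕ → ℝ} (hd : ∀ j, 1 ≤ j → j + 1 ≤ n → 0 < d j)
    (hi : 2 ≤ i) (hin : i + 2 ≤ n) (hN : i ≤ N) {s : State} (hs : Ready n d s)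
    (hst : Stored d i s) (h3 : s.idx 3 = i) (h7 : s.idx 7 = i + 1) (h20 : s.reg 20 = xi d i)
    (h22 : s.reg 22 = d (i + 1)) {x : ℝ} (hx : 0 ≤ x)
    (hroot : xi d i * x + derivQ d i x - xi d i = 0) :
    ∃ s', Runs storeBreak N s s' ∧ s'.storedL (i + 1) = matL d i ∧ s'.flag (i + 1) = 1 ∧
      s'.breakX (i + 1) = 1 - x ∧
      s'.breakY (i + 1) = 4 * d (i + 1) ^ 2 * (1 - x) - xi d i * x ∧
      (∀ A k, A < 2 ∨ 13 < A ∨ k ≠ i + 1 → s'.mem A k = s.mem A k) ∧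
      ∀ a, a ≠ 4 → a ≠ 5 → s'.idx a = s.idx a := by
  have hdi := hd i (by omega) (by omega)
  have hdi' := hd (i + 1) (by omega) (by omega)
  have hxi : 0 < xi d i := by unfold xi; positivity
  set s1 := applyAll s [.idxCopy 4 3, .real 0 (reg 20), .real 1 1, .real 2 (0 - reg 20)] with hs1
  have hrun1 : Runs (block [.idxCopy 4 3, .real 0 (reg 20), .real 1 1, .real 2 (0 - reg 20)]) N s
      s1 := block_runs (by omega) (by simp [SafeAll, Assign.Safe])
  have hframe1 : Frame s s1 := by
    refine ⟨by simp [s1, applyAll, Assign.apply], fun a h1 h2 => ?_, fun r hr => ?_⟩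
    · simp [s1, applyAll, Assign.apply, h1]
    · have : ∀ k, k < 20 → r ≠ k := fun k hk => by omega
      simp [s1, applyAll, Assign.apply, this]
  obtain ⟨s2, hrun2, e6, hframe2⟩ := intersect_runs (s := s1) (x := x) hi le_rfl hN
    (fun j h1 h2 => hd j h1 (by omega)) (hst.congr hi fun A k _ _ => by rw [hframe1.mem])
    (by rw [hframe1.idx 1 (by decide) (by decide), hs.idx1])
    (by rw [hframe1.idx 2 (by decide) (by decide), hs.idx2])
    (by simp [s1, applyAll, Assign.apply, h3])
    (by simp [s1, applyAll, Assign.apply, h20, hxi.le]) (by simp [s1, applyAll, Assign.apply]) hx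
    (by simp [s1, applyAll, Assign.apply, h20]; linarith)
  have hframe := hframe1.trans hframe2
  have e7 : s2.idx 7 = i + 1 := by rw [hframe.idx 7 (by decide) (by decide), h7]
  have e20 : s2.reg 20 = xi d i := by rw [hframe.reg 20 (by decide), h20]
  have e22 : s2.reg 22 = d (i + 1) := by rw [hframe.reg 22 (by decide), h22]
  refine ⟨applyAll s2 storeL, hrun1.seq (hrun2.seq (block_runs (by omega) ?_)), ?_, ?_, ?_, ?_,
    fun A k hA => ?_, fun a h1 h2 => ?_⟩
  · simp [SafeAll, storeL, Assign.Safe]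
  · ext a b
    fin_cases a <;> fin_cases b <;>
      simp [storeL, applyAll, Assign.apply, State.storedL, matL, e7, e20, e22, pow_two, mul_assoc]
  · simp [storeL, applyAll, Assign.apply, State.flag, e7]
  · simp [storeL, applyAll, Assign.apply, State.breakX, e7, e6]
  · simp [storeL, applyAll, Assign.apply, State.breakY, e7, e6, e20, e22, pow_two, mul_assoc]
  · rw [← hframe.mem]
    by_cases hk : k = i + 1
    · have : ∀ B, 2 ≤ B → B ≤ 13 → A ≠ B := fun B h1 h2 => by omega
      simp [storeL, applyAll, Assign.apply, this]
    · simp [storeL, applyAll, Assign.apply, e7, hk]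
  · rw [← hframe.idx a h1 h2]
    simp [storeL, applyAll, Assign.apply]

theorem Ready.congr {n : ℕ} {d : ℕ → ℝ} {s s' : State} (h : Ready n d s)
    (hi : ∀ a, a < 3 → s'.idx a = s.idx a) (hm : ∀ k, s'.mem 24 k = s.mem 24 k) :
    Ready n d s' :=
  ⟨by rw [hi 0 (by omega), h.idx0], by rw [hi 1 (by omega), h.idx1],
    by rw [hi 2 (by omega), h.idx2], fun j h1 h2 => by rw [hm, h.gaps j h1 h2]⟩

theorem Frame.ready {n : ℕ} {d : ℕ → ℝ} {s s' : State} (hf : Frame s s') (h : Ready n d s) :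
    Ready n d s' :=
  h.congr (fun a ha => hf.idx a (by omega) (by omega)) fun k => by rw [hf.mem]

/-- Two line intersections on R_i suffice: the line y = 0 gives its zero u, and if u < 1, the line
ξ_i x + y = ξ_i gives the breakpoint of R_{i+1}. The latter needs only the records up to R_i. -/
theorem buildStep_runs {n i : ℕ} {d : ℕ → ℝ} (hd : ∀ j, 1 ≤ j → j + 1 ≤ n → 0 < d j)
    (hi : 2 ≤ i) (hin : i + 2 ≤ n) {s : State} (hs : Ready n d s) (hst : Stored d i s)
    (h3 : s.idx 3 = i) :
    ∃ s', Runs buildStep n s s' ∧ Ready n d s' ∧ Stored d (i + 1) s' ∧ s'.idx 3 = i + 1 ∧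
      s'.idx 6 = s.idx 6 := by
  have hdi := hd i (by omega) (by omega)
  have hdi' := hd (i + 1) (by omega) (by omega)
  have hxi : 0 < xi d i := by unfold xi; positivity
  have hR := regular hi fun j h1 h2 => hd j h1 (by omega)
  obtain ⟨u, hu⟩ := hR.exists_isInvR hdi le_rfl
  obtain ⟨s1, hrun1, e6, hf1⟩ := findZero_runs (N := n) hd hi (by omega) (by omega) hs hst h3 hu
  have hs1 := hf1.ready hs
  have e13 : s1.idx 3 = i := by rw [hf1.idx 3 (by decide) (by decide), h3]
  obtain ⟨s2, hrun2, hM, hmem2, hidx2, e27, e26, e20, e22, e23⟩ := storeM_runs hd hi hin hs1 e13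
  have hs2 : Ready n d s2 := hs1.congr (fun a ha => hidx2 a (by omega))
    fun k => hmem2 24 k (by omega)
  have hst2 : Stored d i s2 := hst.congr hi fun A k hA hk => by
    rw [hmem2 A k (by omega), hf1.mem]
  have e23i : s2.idx 3 = i := by rw [hidx2 3 (by omega), e13]
  have finish : (∃ s3, Runs (.ite (.realLt 6 23) storeBreak (block [.cell 2 7 0])) n s2 s3 ∧
      StoresNext d s3 i ∧ (∀ A k, A < 2 ∨ 13 < A ∨ k ≠ i + 1 → s3.mem A k = s2.mem A k) ∧
      ∀ a, a ≠ 4 → a ≠ 5 → s3.idx a = s2.idx a) →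
      ∃ s', Runs buildStep n s s' ∧ Ready n d s' ∧ Stored d (i + 1) s' ∧ s'.idx 3 = i + 1 ∧
        s'.idx 6 = s.idx 6 := by
    rintro ⟨s3, hrun3, hnext, hmem3, hidx3⟩
    have hs3 : Ready n d s3 := hs2.congr (fun a ha => hidx3 a (by omega) (by omega))
      fun k => hmem3 24 k (by omega)
    have hst3 : Stored d i s3 := hst2.congr hi fun A k hA hk => hmem3 A k (by omega)
    refine ⟨applyAll s3 [.idxAdd 3 3 1], hrun1.seq ((hrun2.mono (by omega)).seq (hrun3.seq
      (block_runs (by omega) (by simp [SafeAll, Assign.Safe])))), ?_, ⟨fun j h1 h2 => ?_, ?_,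
      fun j h1 h2 => ?_⟩, ?_, ?_⟩
    · refine hs3.congr (fun a ha => ?_) fun k => ?_
      · simp [applyAll, Assign.apply, show a ≠ 3 by omega]
      · simp [applyAll, Assign.apply]
    · simpa [applyAll, Assign.apply] using hs3.gaps j h1 (by omega)
    · exact hst3.first.congr rfl rfl fun k => rfl
    · rcases Nat.lt_or_ge j i with hj | hj
      · exact (hst3.next j h1 (by omega)).congr fun A _ _ => rfl
      · obtain rfl : j = i := by omega
        exact hnext.congr fun A _ _ => rfl
    · simp [applyAll, Assign.apply, hs3.idx1, hidx3, e23i]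
    · simp [applyAll, Assign.apply, hidx3, hidx2, hf1.idx]
  refine finish ?_
  rcases lt_or_ge u 1 with hu1 | hu1
  · obtain ⟨x, hx, hroot⟩ := hR.exists_line_root hdi hxi.le (neg_nonpos.2 hxi.le)
    rw [← sub_eq_add_neg] at hroot
    obtain ⟨b1, b2, b3, b4, b5⟩ := hR.breakpoint hi hdi hdi' hu1 hu hx hroot
    obtain ⟨s3, hrun3, hL, hfl, hX, hY, hmem3, hidx3⟩ := storeBreak_runs (N := n) hd hi hin
      (by omega) hs2 hst2 e23i e27 e20 e22 hx hroot
    have hM3 : s3.storedM (i + 1) = matM d i := by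
      rw [← hM]; ext a b; exact hmem3 _ _ (by omega)
    refine ⟨s3, Runs.iteTrue ⟨by decide, by decide⟩ ?_ (by omega) hrun3, ⟨hM3, Or.inr
      ⟨⟨u, hu1, hu⟩, hfl, hL, ?_, ?_, ?_, ?_, ?_⟩⟩, hmem3, hidx3⟩
    · simp only [Test.Holds]
      rwa [e26, e6, e23]
    · rwa [hX]
    · rwa [hX]
    · rw [hX, hY, b3]
    · rw [hX, hL]; exact b4
    · rw [hX, hM3]; exact b5
  · set s3 := applyAll s2 [.cell 2 7 0] with hs3
    have hmem3 : ∀ A k, A < 2 ∨ 13 < A ∨ k ≠ i + 1 → s3.mem A k = s2.mem A k := by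
      intro A k hA
      have : ¬ (A = 2 ∧ k = i + 1) := by omega
      simp [s3, applyAll, Assign.apply, e27, this]
    have hM3 : s3.storedM (i + 1) = matM d i := by
      rw [← hM]; ext a b; exact hmem3 _ _ (by omega)
    refine ⟨s3, Runs.iteFalse ⟨by decide, by decide⟩ ?_ (by omega) (block_runs (by omega)
      (by simp [SafeAll, Assign.Safe])), ⟨hM3, Or.inl ⟨⟨u, hu1, hu⟩, ?_, ?_⟩⟩, hmem3, ?_⟩
    · simp only [Test.Holds]
      rw [e26, e6, e23]
      exact hu1.not_gt
    · simp [s3, applyAll, Assign.apply, State.flag, e27]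
    · rw [hM3]
      exact fun x hx => hR.transfers_matM_of_one_le hi hdi hdi' hu1 hu hx
    · simp [s3, applyAll, Assign.apply]

theorem buildLoop_runs {n : ℕ} (hn : 3 ≤ n) {d : ℕ → ℝ} (hd : ∀ j, 1 ≤ j → j + 1 ≤ n → 0 < d j)
    {s : State} (hs : Ready n d s) (hst : Stored d 2 s) (h3 : s.idx 3 = 2)
    (h6 : s.idx 6 = n - 1) :
    ∃ s', Runs (.loop (.idxLt 3 6) buildStep) (n * (n - 3 + 1)) s s' ∧ Ready n d s' ∧
      Stored d (n - 1) s' ∧ s'.idx 3 = n - 1 := by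
  -- With k iterations left, the records reach index n - 1 - k, which starts at 2 and ends at n - 1.
  let I : ℕ → State → Prop := fun k t => k + 3 ≤ n ∧ t.idx 3 = n - 1 - k ∧ t.idx 6 = n - 1 ∧
    Ready n d t ∧ Stored d (n - 1 - k) t
  have hloop := Runs.loop (P := buildStep) (b := .idxLt 3 6)
    (N := n) trivial I ?_ ?_ (by omega) (n - 3) s
    ⟨by omega, by omega, h6, hs, by rwa [show n - 1 - (n - 3) = 2 by omega]⟩
  · obtain ⟨s', hrun, -, e3, -, hr, hst'⟩ := hloop
    exact ⟨s', hrun, hr, hst', e3⟩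
  · rintro k t ⟨hk, e3, e6, hr, hst'⟩
    refine ⟨by simp only [Test.Holds]; omega, ?_⟩
    obtain ⟨t', hrun, hr', hst'', e3', e6'⟩ := buildStep_runs hd (by omega) (by omega) hr hst' e3
    have hk' : n - 1 - (k + 1) + 1 = n - 1 - k := by omega
    rw [hk'] at hst'' e3'
    exact ⟨t', hrun, by omega, e3', by omega, hr', hst''⟩
  · rintro t ⟨-, e3, e6, -⟩
    simp only [Test.Holds]; omega

theorem storeMax_runs {N : ℕ} (hN : 1 ≤ N) (s : State) :
    ∃ s', Runs storeMax N s s' ∧ s'.idx = s.idx ∧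
      ∀ A k, s'.mem A k = if A = 1 ∧ k = s.idx 3 then max (s.reg 6) (s.reg 23) else s.mem A k := by
  by_cases h : s.reg 6 < s.reg 23
  · refine ⟨applyAll (applyAll s [.real 6 (reg 23)]) [.cell 1 3 (reg 6)],
      (Runs.iteTrue (b := .realLt 6 23)
         ⟨by decide, by decide⟩ h hN (block_runs hN ?_)).seq (block_runs hN ?_), ?_,
      fun A k => ?_⟩
    · simp [SafeAll, Assign.Safe]
    · simp [SafeAll, Assign.Safe]
    · simp [applyAll, Assign.apply]
    · rw [max_eq_right h.le]
      simp [applyAll, Assign.apply]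
  · refine ⟨applyAll s [.cell 1 3 (reg 6)],
      (Runs.iteFalse (b := .realLt 6 23)
         ⟨by decide, by decide⟩ h hN (Runs.skip hN)).seq (block_runs hN ?_), ?_,
      fun A k => ?_⟩
    · simp [SafeAll, Assign.Safe]
    · simp [applyAll, Assign.apply]
    · rw [max_eq_left (not_lt.1 h)]
      simp [applyAll, Assign.apply]

/-! ### Back-substitution on the machine -/

/-- The weights `w i, …, w (n - 1)` have been computed. -/
structure Solved (n : ℕ) (d : ℕ → ℝ) (i : ℕ) (s : State) : Prop where
  ready : Ready n d s
  stored : Stored d (n - 1) s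
  last : ∃ u, IsInvR d (n - 1) 0 u ∧ s.weight (n - 1) = max u 1
  middle : ∀ j, i ≤ j → j + 2 ≤ n →
    ∃ u, IsInvR d j (xi d j * s.weight (j + 1)) u ∧ s.weight j = max u (1 - s.weight (j + 1))

theorem lastWeight_runs {n : ℕ} (hn : 3 ≤ n) {d : ℕ → ℝ}
    (hd : ∀ j, 1 ≤ j → j + 1 ≤ n → 0 < d j) {s : State} (hs : Ready n d s)
    (hst : Stored d (n - 1) s) (h3 : s.idx 3 = n - 1) :
    ∃ s', Runs lastWeight n s s' ∧ Solved n d (n - 1) s' ∧ s'.idx 3 = n - 1 := by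
  have hR := regular (show 2 ≤ n - 1 by omega) fun j h1 h2 => hd j h1 (by omega)
  obtain ⟨u, hu⟩ := hR.exists_isInvR (hd (n - 1) (by omega) (by omega)) le_rfl
  obtain ⟨s1, hrun1, e6, hf1⟩ := findZero_runs (N := n) hd (by omega) (by omega) (by omega) hs hst
    h3 hu
  set s2 := applyAll s1 [.real 23 1] with hs2
  obtain ⟨s3, hrun3, hidx3, hmem3⟩ := storeMax_runs (N := n) (by omega) s2
  have hidx : ∀ a, a ≠ 4 → a ≠ 5 → s3.idx a = s.idx a := fun a h1 h2 => by
    rw [hidx3, ← hf1.idx a h1 h2]; simp [s2, applyAll, Assign.apply]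
  have hmem : ∀ A k, 2 ≤ A → s3.mem A k = s.mem A k := fun A k hA => by
    rw [hmem3, if_neg (by omega), ← hf1.mem]; simp [s2, applyAll, Assign.apply]
  refine ⟨s3, hrun1.seq ((block_runs (by omega) (by simp [SafeAll, Assign.Safe])).seq hrun3),
    ⟨hs.congr (fun a ha => hidx a (by omega) (by omega)) fun k => hmem 24 k (by omega),
      hst.congr (by omega) fun A k hA _ => hmem A k hA, ⟨u, hu, ?_⟩, fun j h1 h2 => by omega⟩, ?_⟩
  · rw [State.weight, hmem3, if_pos]
    · simp [s2, applyAll, Assign.apply, e6]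
    · simp [s2, applyAll, Assign.apply, hf1.idx, h3]
  · rw [hidx 3 (by decide) (by decide), h3]

theorem Solved.weight_nonneg {n i : ℕ} {d : ℕ → ℝ} {s : State} (h : Solved n d i s) {j : ℕ}
    (h1 : i ≤ j) (h2 : j + 1 ≤ n) : 0 ≤ s.weight j := by
  by_cases hj : j + 1 = n
  · obtain ⟨u, hu, hw⟩ := h.last
    rw [show j = n - 1 by omega, hw]
    exact hu.1.trans (le_max_left _ _)
  · obtain ⟨u, hu, hw⟩ := h.middle j h1 (by omega)
    rw [hw]
    exact hu.1.trans (le_max_left _ _)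

theorem backStep_runs {n i : ℕ} {d : ℕ → ℝ} (hd : ∀ j, 1 ≤ j → j + 1 ≤ n → 0 < d j) (hi : 2 ≤ i)
    (hin : i + 2 ≤ n) {s : State} (hs : Solved n d (i + 1) s) (h3 : s.idx 3 = i + 1) :
    ∃ s', Runs backStep n s s' ∧ Solved n d i s' ∧ s'.idx 3 = i := by
  have hdi := hd i (by omega) (by omega)
  have hdi' := hd (i + 1) (by omega) (by omega)
  have hxi : 0 < xi d i := by unfold xi; positivity
  have hR := regular hi fun j h1 h2 => hd j h1 (by omega)
  have hw := hs.weight_nonneg (j := i + 1) le_rfl (by omega)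
  obtain ⟨u, hu⟩ := hR.exists_isInvR hdi (mul_nonneg hxi.le hw)
  have g1 := hs.ready.gaps i (by omega) (by omega)
  have g2 := hs.ready.gaps (i + 1) (by omega) (by omega)
  have i1 := hs.ready.idx1
  set l : List Assign := [.idxCopy 7 3, .idxSub 3 3 1, .real 25 (arr 1 7),
    .real 20 (2 * arr 24 3 * arr 24 7), .idxCopy 4 3, .real 0 0, .real 1 1,
    .real 2 (0 - reg 20 * reg 25)] with hl
  set s1 := applyAll s l with hs1
  have hrun1 : Runs (block l) n s s1 :=
    block_runs (by omega) (by simp [l, SafeAll, Assign.Safe])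
  have hmem1 : s1.mem = s.mem := by simp [s1, l, applyAll, Assign.apply]
  have hidx1 : ∀ a, a < 3 → s1.idx a = s.idx a := by
    intro a ha
    simp [s1, l, applyAll, Assign.apply, show a ≠ 3 by omega, show a ≠ 4 by omega,
      show a ≠ 7 by omega]
  have e13 : s1.idx 3 = i := by simp [s1, l, applyAll, Assign.apply, h3, i1]
  have e25 : s1.reg 25 = s.weight (i + 1) := by
    simp [s1, l, applyAll, Assign.apply, h3, State.weight]
  have hs1r : Ready n d s1 := hs.ready.congr hidx1 fun k => by rw [hmem1]
  -- R_i⁻¹(ξ_i w_{i+1}) is the intersection with the horizontal line y = ξ_i w_{i+1}.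
  obtain ⟨s2, hrun2, e6, hf2⟩ := intersect_runs (s := s1) (x := u) (m := n - 1) (N := n) hi
    (by omega) (by omega) (fun j h1 h2 => hd j h1 (by omega))
    (hs.stored.congr (by omega) fun A k _ _ => by rw [hmem1]) hs1r.idx1 hs1r.idx2
    (by simp [s1, l, applyAll, Assign.apply, h3, i1])
    (by simp [s1, l, applyAll, Assign.apply]) (by simp [s1, l, applyAll, Assign.apply]) hu.1
    (by
      rw [hu.2]
      simp [s1, l, applyAll, Assign.apply, h3, i1, g1, g2, State.weight, xi])
  set s3 := applyAll s2 [.real 23 (1 - reg 25)] with hs3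
  obtain ⟨s4, hrun4, hidx4, hmem4⟩ := storeMax_runs (N := n) (by omega) s3
  have e33 : s3.idx 3 = i := by simp [s3, applyAll, Assign.apply, hf2.idx, e13]
  have hidx : ∀ a, a ≠ 4 → a ≠ 5 → s4.idx a = s1.idx a := fun a h1 h2 => by
    rw [hidx4, ← hf2.idx a h1 h2]; simp [s3, applyAll, Assign.apply]
  have hmem : ∀ A k, A ≠ 1 ∨ k ≠ i → s4.mem A k = s.mem A k := fun A k hA => by
    rw [hmem4, e33, if_neg (by omega), ← hmem1, ← hf2.mem]; simp [s3, applyAll, Assign.apply]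
  have hwt : ∀ j, j ≠ i → s4.weight j = s.weight j := fun j hj => hmem 1 j (Or.inr hj)
  have hwi : s4.weight i = max u (1 - s.weight (i + 1)) := by
    rw [State.weight, hmem4, e33, if_pos ⟨rfl, rfl⟩]
    simp [s3, applyAll, Assign.apply, e6, hf2.reg, e25]
  refine ⟨s4, hrun1.seq (hrun2.seq ((block_runs (by omega) (by simp [SafeAll, Assign.Safe])).seq
    hrun4)), ⟨hs1r.congr (fun a ha => hidx a (by omega) (by omega)) fun k => ?_,
    hs.stored.congr (by omega) fun A k hA _ => hmem A k (by omega), ?_, fun j h1 h2 => ?_⟩, ?_⟩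
  · rw [hmem 24 k (by omega), hmem1]
  · rw [hwt _ (by omega)]
    exact hs.last
  · rw [hwt (j + 1) (by omega)]
    by_cases hj : j = i
    · subst hj
      exact ⟨u, hu, hwi⟩
    · rw [hwt j hj]
      exact hs.middle j (by omega) h2
  · rw [hidx 3 (by decide) (by decide), e13]

theorem backLoop_runs {n : ℕ} (hn : 3 ≤ n) {d : ℕ → ℝ} (hd : ∀ j, 1 ≤ j → j + 1 ≤ n → 0 < d j)
    {s : State} (hs : Solved n d (n - 1) s) (h3 : s.idx 3 = n - 1) :
    ∃ s', Runs (.loop (.idxLt 2 3) backStep) (n * (n - 3 + 1)) s s' ∧ Solved n d 2 s' := by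
  let I : ℕ → State → Prop := fun k t => k + 3 ≤ n ∧ t.idx 3 = k + 2 ∧ Solved n d (k + 2) t
  have hloop := Runs.loop (P := backStep) (b := .idxLt 2 3)
    (N := n) trivial I ?_ ?_ (by omega) (n - 3) s
    ⟨by omega, by omega, by rwa [show n - 3 + 2 = n - 1 by omega]⟩
  · obtain ⟨s', hrun, -, -, hs'⟩ := hloop
    exact ⟨s', hrun, hs'⟩
  · rintro k t ⟨hk, e3, ht⟩
    have := ht.ready.idx2
    refine ⟨by simp only [Test.Holds]; omega, ?_⟩
    obtain ⟨t', hrun, ht', e3'⟩ := backStep_runs (i := k + 2) hd (by omega) (by omega) ht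
      (by omega)
    exact ⟨t', hrun, by omega, e3', ht'⟩
  · rintro t ⟨-, e3, ht⟩
    have := ht.ready.idx2
    simp only [Test.Holds]; omega

theorem firstWeight_runs {n : ℕ} (hn : 3 ≤ n) {d : ℕ → ℝ}
    (hd : ∀ j, 1 ≤ j → j + 1 ≤ n → 0 < d j) {s : State} (hs : Solved n d 2 s) :
    ∃ s', Runs firstWeight 1 s s' ∧ Stored d (n - 1) s' ∧ BackSubstitution n d s'.weight := by
  have h1 := hd 1 le_rfl (by omega)
  have g1 := hs.ready.gaps 1 le_rfl (by omega)
  have g2 := hs.ready.gaps 2 (by omega) (by omega)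
  set l : List Assign := [.real 6 (arr 24 2 / (2 * arr 24 1) * arr 1 2), .real 23 1,
    .idxConst 3 1] with hl
  set s1 := applyAll s l with hs1
  obtain ⟨s2, hrun2, hidx2, hmem2⟩ := storeMax_runs le_rfl s1
  have e13 : s1.idx 3 = 1 := by simp [s1, l, applyAll, Assign.apply]
  have hmem1 : s1.mem = s.mem := by simp [s1, l, applyAll, Assign.apply]
  have hmem : ∀ A k, A ≠ 1 ∨ k ≠ 1 → s2.mem A k = s.mem A k := fun A k hA => by
    rw [hmem2, e13, if_neg (by omega), hmem1]
  have hwt : ∀ j, j ≠ 1 → s2.weight j = s.weight j := fun j hj => hmem 1 j (Or.inr hj)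
  refine ⟨s2, (block_runs le_rfl ?_).seq hrun2,
    hs.stored.congr (by omega) fun A k hA _ => hmem A k (by omega), ⟨fun h => by omega,
    fun _ => ?_, fun j hj hjn => ?_, fun _ => ?_⟩⟩
  · simp [SafeAll, Assign.Safe, hs.ready.idx1, g1, h1.ne']
  · rw [hwt _ (by omega)]
    exact hs.last
  · rw [hwt (j + 1) (by omega), hwt j (by omega)]
    exact hs.middle j hj hjn
  · rw [hwt 2 (by omega), State.weight, hmem2, e13, if_pos ⟨rfl, rfl⟩]
    simp [s1, l, applyAll, Assign.apply, hs.ready.idx1, hs.ready.idx2, g1, g2, State.weight]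

theorem computeWeights_runs {n : ℕ} (hn : 3 ≤ n) {p : ℕ → ℝ} (hp : StrictMonoOn p (Icc 1 n))
    {s : State} (h0 : s.idx 0 = n) (h1 : s.idx 1 = 1) (h2 : s.idx 2 = 2) (h3 : s.idx 3 = 1)
    (hps : ∀ j, 1 ≤ j → j ≤ n → s.mem 0 j = p j) :
    ∃ s', Runs computeWeights (n * n) s s' ∧ Stored (gap p) (n - 1) s' ∧
      BackSubstitution n (gap p) s'.weight := by
  have hd : ∀ j, 1 ≤ j → j + 1 ≤ n → 0 < gap p j := fun j h1 h2 => gap_pos hp h1 h2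
  have hn1 : n ≤ n * n := Nat.le_mul_self n
  -- The two loops whose bodies perform intersections have n - 3 iterations with a body bound
  -- proportional to n; they dominate the running time.
  have hn2 : n * (n - 3 + 1) ≤ n * n := Nat.mul_le_mul_left _ (by omega)
  obtain ⟨s1, hrun1, hr1⟩ := gapLoop_runs (by omega) h0 h1 h2 h3 hps
  obtain ⟨s2, hrun2, hr2, hst2, e23, e26⟩ := storeFirst_runs hn hd hr1
  obtain ⟨s3, hrun3, hr3, hst3, e33⟩ := buildLoop_runs hn hd hr2 hst2 e23 e26
  obtain ⟨s4, hrun4, hs4, e43⟩ := lastWeight_runs hn hd hr3 hst3 e33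
  obtain ⟨s5, hrun5, hs5⟩ := backLoop_runs hn hd hs4 e43
  obtain ⟨s6, hrun6, hst6, hb6⟩ := firstWeight_runs hn hd hs5
  exact ⟨s6, (hrun1.mono (by omega)).seq ((hrun2.mono (by omega)).seq ((hrun3.mono hn2).seq
    ((hrun4.mono hn1).seq ((hrun5.mono hn2).seq (hrun6.mono (by omega)))))), hst6, hb6⟩

theorem optimalWeights_runs {n : ℕ} (hn : 2 ≤ n) {p : ℕ → ℝ} (hp : StrictMonoOn p (Icc 1 n)) :
    ∃ s, Runs optimalWeights (n * n) (inputState n p) s ∧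
      (3 ≤ n → Stored (gap p) (n - 1) s) ∧ BackSubstitution n (gap p) s.weight := by
  have hN : 1 ≤ n * n := by nlinarith
  set s1 := applyAll (inputState n p) [.idxConst 1 1, .idxConst 2 2, .idxConst 3 1] with hs1
  have hrun1 : Runs (block [.idxConst 1 1, .idxConst 2 2, .idxConst 3 1]) (n * n) (inputState n p)
      s1 := block_runs hN (by simp [SafeAll, Assign.Safe])
  have e0 : s1.idx 0 = n := by simp [s1, applyAll, Assign.apply, inputState]
  have e1 : s1.idx 1 = 1 := by simp [s1, applyAll, Assign.apply]
  have e2 : s1.idx 2 = 2 := by simp [s1, applyAll, Assign.apply]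
  have e3 : s1.idx 3 = 1 := by simp [s1, applyAll, Assign.apply]
  by_cases hn2 : n ≤ 2
  · refine ⟨applyAll s1 [.cell 1 1 1], hrun1.seq (Runs.iteTrue trivial ?_ hN (block_runs hN ?_)),
      fun h => by omega, ⟨fun _ => ?_, fun h => by omega, fun i h1 h2 => by omega,
      fun h => by omega⟩⟩
    · simp only [Test.Holds]; omega
    · simp [SafeAll, Assign.Safe]
    · simp [applyAll, Assign.apply, State.weight, e1]
  · have hps : ∀ j, 1 ≤ j → j ≤ n → s1.mem 0 j = p j := by
      intro j h1 h2
      simp [s1, applyAll, Assign.apply, inputState, h2, show ¬ j = 0 by omega,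
        Nat.one_le_iff_ne_zero]
    obtain ⟨s2, hrun2, hst, hb⟩ := computeWeights_runs (by omega) hp e0 e1 e2 e3 hps
    refine ⟨s2, hrun1.seq (Runs.iteFalse trivial ?_ hN hrun2), fun _ => hst, hb⟩
    simp only [Test.Holds]; omega

end DKS

theorem theorem2 :
    ∃ (P : DKS.Prog) (C : ℕ), ∀ n : ℕ, 2 ≤ n →
      ∀ p : ℕ → ℝ, StrictMonoOn p (Set.Icc 1 n) →
        (∀ i, 2 ≤ i → i + 1 ≤ n → DKS.WellDefined (DKS.gap p) i) ∧
        ∃ (t : ℕ) (s : DKS.State), DKS.Exec P (DKS.inputState n p) t s ∧ t ≤ C * n ^ 2 ∧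
          DKS.IsOptimal n p (DKS.chainWeights s.weight) ∧
          (3 ≤ n → DKS.StoresFirst (DKS.gap p) s) ∧
          (∀ i, 2 ≤ i → i + 2 ≤ n → DKS.StoresNext (DKS.gap p) s i) ∧
          DKS.BackSubstitution n (DKS.gap p) s.weight := by
  -- The constant C is the static cost of the program text, which does not depend on n; `Runs`
  -- bounds the steps by this cost times n * n.
  refine ⟨DKS.optimalWeights, DKS.optimalWeights.cost, fun n hn p hp => ⟨fun i hi hin => ?_, ?_⟩⟩
  · exact (DKS.regular hi fun j h1 h2 => DKS.gap_pos hp h1 (by omega)).wellDefined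
      (DKS.gap_pos hp (by omega) hin)
  · obtain ⟨s', hrun, hst, hb⟩ := DKS.optimalWeights_runs hn hp
    obtain ⟨t, s, hexec, ht, hagree⟩ := hrun _ (DKS.Agree.refl _)
    have hb' : DKS.BackSubstitution n (DKS.gap p) s.weight := by
      have : s.weight = s'.weight := by
        funext i
        rw [DKS.State.weight, hagree.mem, DKS.State.weight]
      rwa [this]
    have hst' : 3 ≤ n → DKS.Stored (DKS.gap p) (n - 1) s := fun h =>
      (hst h).congr (by omega) fun A k _ _ => by rw [hagree.mem]
    exact ⟨t, s, hexec, by rwa [pow_two], hb'.isOptimal hn hp, fun h => (hst' h).first,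
      fun i hi hin => (hst' (by omega)).next i hi (by omega), hb'⟩
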